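/- Let $\mathcal{V}$ be a monoidal model category: a complete and cocomplete category with a model structure and a monoidal structure $(\otimes, I)$, closed on both sides (symmetry is not required), that satisfies the pushout-product axiom and the unit axiom. A class of maps in $\mathcal{V}$ is \emph{monoidally saturated} if it is closed under cobase change, transfinite composition, retracts and tensoring with arbitrary objects (on either side). A \emph{$\otimes$-cofibration} is a map in the least monoidally saturated class containing the cofibrations. $\mathcal{V}$ is \emph{compactly generated} if it is cofibrantly generated, every object is small relative to the $\otimes$-cofibrations, and the weak equivalences are closed under filtered colimits along $\otimes$-cofibrations (that is, if $F\to G$ is a natural weak equivalence between small filtered diagrams all of whose transition maps are $\otimes$-cofibrations, then $\operatorname{colim}F\to\operatorname{colim}G$ is a weak equivalence). $\mathcal{V}$ is \emph{adequate} if it is compactly generated and, for every non-symmetric coloured operad $\mathcal{P}$ in sets, the category of $\mathcal{P}$-algebras in $\mathcal{V}$ carries a transferred model structure, i.e. a model structure whose fibrations and weak equivalences are the maps that are so in $\mathcal{V}$ at each colour. \textbf{Lemma.} Let $\mathcal{V}$ be an adequate monoidal model category whose unit $I$ is cofibrant. Then $\mathcal{V}$ has an interval in the sense of Berger--Moerdijk: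 there are an object $H$, maps $0,1\colon I\to H$ and $\varepsilon\colon H\to I$, and a multiplication $\mu\colon H\otimes H\to H$ such that \begin{itemize} \item $I\sqcup I\xrightarrow{(0,1)}H\xrightarrow{\ \varepsilon\ }I$ is a factorisation of the folding map into a cofibration $(0,1)$ followed by a weak equivalence $\varepsilon$; \item $\mu$ is associative, and $0$ is neutral for $\mu$: $\mu\circ(0\otimes H)$ and $\mu\circ(H\otimes 0)$ are the canonical isomorphisms $I\otimes H\cong H$ and $H\otimes I\cong H$; \item $1$ is absorbing for $\mu$: $\mu\circ(1\otimes H)$ and $\mu\circ(H\otimes 1)$ are the composites $I\otimes H\cong H\xrightarrow{\varepsilon}I\xrightarrow{1}H$ and $H\otimes I\cong H\xrightarrow{\varepsilon}I\xrightarrow{1}H$. \end{itemize} -/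

import Mathlib

open CategoryTheory MonoidalCategory Limits HomotopicalAlgebra

universe v u

/-! ### Non-symmetric coloured operads in sets and their algebras -/

/-- A non-symmetric coloured operad in sets with set of colours `C`: for each list `cs` of input
colours and each output colour `c` a set of operations `Op cs c`, with identities and partial
compositions (plugging an operation into one input of another one), which are unital and
associative (for nested and for disjoint insertions). -/
structure NSOperad (C : Type v) where
  Op : List C → C → Type v
  one (c : C) : Op [c] c
  /-- `comp l r m f g` plugs `g` into the input of `f` that comes after the inputs `l`. -/
  comp (l r m : List C) {d c : C} (f : Op (l ++ d :: r) c) (g : Op m d) : Op (l ++ (m ++ r)) c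
  one_comp {m : List C} {d : C} (g : Op m d) : HEq (comp [] [] m (one d) g) g
  comp_one (l r : List C) {d c : C} (f : Op (l ++ d :: r) c) : comp l r [d] f (one d) = f
  /-- Nested insertions: plugging `h` into `g` and the result into `f`. -/
  comp_comp (l r m₁ m₂ n : List C) {e d c : C}
    (f : Op (l ++ d :: r) c) (g : Op (m₁ ++ e :: m₂) d) (h : Op n e) :
    HEq (comp l r (m₁ ++ (n ++ m₂)) f (comp m₁ m₂ n g h))
      (comp (l ++ m₁) (m₂ ++ r) n
        (cast (congrArg (fun s ↦ Op s c) (by simp)) (comp l r (m₁ ++ e :: m₂) f g)) h)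
  /-- Disjoint insertions: plugging `g` and `h` into two different inputs of `f`. -/
  comp_comm (l m r p q : List C) {d e c : C}
    (f : Op (l ++ d :: (m ++ e :: r)) c) (g : Op p d) (h : Op q e) :
    HEq (comp (l ++ (p ++ m)) r q
        (cast (congrArg (fun s ↦ Op s c) (by simp)) (comp l (m ++ e :: r) p f g)) h)
      (comp l (m ++ (q ++ r)) p
        (cast (congrArg (fun s ↦ Op s c) (by simp))
          (comp (l ++ d :: m) r q (cast (congrArg (fun s ↦ Op s c) (by simp)) f) h)) g)

section Algebras

variable {V : Type u} [Category.{v} V] [MonoidalCategory V]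

/-- `A c₁ ⊗ (A c₂ ⊗ (⋯ ⊗ (A cₙ ⊗ 𝟙_ V)))` for a list of colours `c₁, …, cₙ`. -/
def listTensor {C : Type v} (A : C → V) : List C → V
  | [] => 𝟙_ V
  | c :: cs => A c ⊗ listTensor A cs

/-- The functoriality of `listTensor` in the family of objects. -/
def listTensorMap {C : Type v} {A B : C → V} (φ : ∀ c, A c ⟶ B c) :
    ∀ cs : List C, listTensor A cs ⟶ listTensor B cs
  | [] => 𝟙 (𝟙_ V)
  | c :: cs => φ c ⊗ₘ listTensorMap φ cs

/-- The canonical isomorphism between the tensor product of a concatenated list and the tensor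
product of the two tensor products. -/
def listTensorAppend {C : Type v} (A : C → V) :
    ∀ m r : List C, listTensor A (m ++ r) ≅ listTensor A m ⊗ listTensor A r
  | [], r => (λ_ (listTensor A r)).symm
  | c :: m, r => whiskerLeftIso (A c) (listTensorAppend A m r) ≪≫
      (α_ (A c) (listTensor A m) (listTensor A r)).symm

/-- The morphism which applies `φ : A m₁ ⊗ ⋯ ⊗ A mₖ ⟶ A d` to the middle factors and the identity
to the others. -/
def listTensorInsert {C : Type v} (A : C → V) (r m : List C) {d : C}
    (φ : listTensor A m ⟶ A d) :
    ∀ l : List C, listTensor A (l ++ (m ++ r)) ⟶ listTensor A (l ++ d :: r)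
  | [] => (listTensorAppend A m r).hom ≫ φ ▷ listTensor A r
  | c :: l => A c ◁ listTensorInsert A r m φ l

theorem listTensorMap_id {C : Type v} (A : C → V) (cs : List C) :
    listTensorMap (fun c ↦ 𝟙 (A c)) cs = 𝟙 (listTensor A cs) := by
  induction cs with
  | nil => rfl
  | cons c cs ih => simp [listTensorMap, ih, listTensor]

theorem listTensorMap_comp {C : Type v} {A B D : C → V} (φ : ∀ c, A c ⟶ B c)
    (ψ : ∀ c, B c ⟶ D c) (cs : List C) :
    listTensorMap (fun c ↦ φ c ≫ ψ c) cs = listTensorMap φ cs ≫ listTensorMap ψ cs := by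
  induction cs with
  | nil => exact (Category.id_comp (𝟙 (𝟙_ V))).symm
  | cons c cs ih =>
    rw [listTensorMap, ih]
    exact (tensorHom_comp_tensorHom _ _ _ _).symm

variable (V) in
/-- An algebra in the monoidal category `V` over the non-symmetric coloured operad `P`. -/
structure NSOperad.Algebra {C : Type v} (P : NSOperad.{v} C) where
  obj : C → V
  act {cs : List C} {c : C} (p : P.Op cs c) : listTensor obj cs ⟶ obj c
  act_one (c : C) : act (P.one c) = (ρ_ (obj c)).hom
  act_comp (l r m : List C) {d c : C} (f : P.Op (l ++ d :: r) c) (g : P.Op m d) :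
    act (P.comp l r m f g) = listTensorInsert obj r m (act g) l ≫ act f

namespace NSOperad.Algebra

variable {C : Type v} {P : NSOperad.{v} C}

/-- A morphism of algebras: a family of morphisms, one for each colour, that commutes with all
operations. -/
@[ext]
structure Hom (A B : P.Algebra V) where
  app (c : C) : A.obj c ⟶ B.obj c
  comm {cs : List C} {c : C} (p : P.Op cs c) :
    A.act p ≫ app c = listTensorMap app cs ≫ B.act p

instance : Category (P.Algebra V) where
  Hom := Hom
  id A := { app := fun c ↦ 𝟙 (A.obj c), comm := fun p ↦ by simp [listTensorMap_id] }
  comp φ ψ :=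
    { app := fun c ↦ φ.app c ≫ ψ.app c
      comm := fun p ↦ by
        rw [listTensorMap_comp, ← Category.assoc, φ.comm, Category.assoc, ψ.comm,
          Category.assoc] }
  id_comp φ := by apply Hom.ext; funext c; exact Category.id_comp _
  comp_id φ := by apply Hom.ext; funext c; exact Category.comp_id _
  assoc φ ψ χ := by apply Hom.ext; funext c; exact Category.assoc _ _ _

end NSOperad.Algebra

end Algebras

/-! ### Monoidal model categories, compact generation, adequacy -/

section ModelCategories

variable {V : Type u} [Category.{v} V]

/-- `A` is small relative to `W`: for some regular cardinal `κ`, the functor `Hom(A, -)` preserves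
the colimits of all `κ`-filtered transfinite sequences whose successive maps lie in `W`. -/
def IsSmallRelativeTo (W : MorphismProperty V) (A : V) : Prop :=
  ∃ (κ : Cardinal.{v}) (_ : Fact κ.IsRegular),
    ∀ (J : Type v) [LinearOrder J] [SuccOrder J] [OrderBot J] [WellFoundedLT J]
      [IsCardinalFiltered J κ] {X Y : V} (f : X ⟶ Y) (hf : W.TransfiniteCompositionOfShape J f),
      PreservesColimit hf.F (coyoneda.obj (Opposite.op A))

/-- The relative `I`-cell complexes: transfinite compositions of cobase changes of maps in `I`. -/
def relativeCells (I : MorphismProperty V) : MorphismProperty V :=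
  MorphismProperty.transfiniteCompositions.{v} I.pushouts

variable (V) in
/-- The model category `V` is cofibrantly generated: there are (small) sets `I` and `J` of maps,
with domains small relative to `I`-cells and `J`-cells respectively, such that the trivial
fibrations are the maps with the right lifting property with respect to `I`, and the fibrations
those with the right lifting property with respect to `J`. -/
def IsCofibrantlyGenerated [ModelCategory V] : Prop :=
  ∃ I J : MorphismProperty V,
    MorphismProperty.IsSmall.{v} I ∧ MorphismProperty.IsSmall.{v} J ∧
    (∀ ⦃A B : V⦄ (i : A ⟶ B), I i → IsSmallRelativeTo (relativeCells I) A) ∧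
    (∀ ⦃A B : V⦄ (j : A ⟶ B), J j → IsSmallRelativeTo (relativeCells J) A) ∧
    trivialFibrations V = I.rlp ∧ fibrations V = J.rlp

variable [MonoidalCategory V]

/-- The pushout-product `(A ⊗ Y) ⊔_{A ⊗ X} (B ⊗ X) ⟶ B ⊗ Y` of `f : A ⟶ B` and `g : X ⟶ Y`. -/
noncomputable def pushoutProductMap [HasPushouts V] {A B X Y : V} (f : A ⟶ B) (g : X ⟶ Y) :
    pushout (A ◁ g) (f ▷ X) ⟶ B ⊗ Y :=
  pushout.desc (f ▷ Y) (B ◁ g) (whisker_exchange f g)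

variable (V) in
/-- A monoidal model category: the tensor product is closed on both sides and satisfies the
pushout-product axiom and the unit axiom. (No symmetry is required.) -/
structure IsMonoidalModelCategory [ModelCategory V] : Prop where
  closed_left (A : V) : (tensorLeft A).IsLeftAdjoint
  closed_right (A : V) : (tensorRight A).IsLeftAdjoint
  pushoutProduct {A B X Y : V} (f : A ⟶ B) (g : X ⟶ Y) [Cofibration f] [Cofibration g] :
    Cofibration (pushoutProductMap f g) ∧
      (WeakEquivalence f ∨ WeakEquivalence g → WeakEquivalence (pushoutProductMap f g))
  unit {Q X : V} (q : Q ⟶ 𝟙_ V) [IsCofibrant Q] [WeakEquivalence q] [IsCofibrant X] :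
    WeakEquivalence (q ▷ X) ∧ WeakEquivalence (X ◁ q)

/-- A class of maps is monoidally saturated if it is closed under cobase change, transfinite
composition, retracts, and tensoring with arbitrary objects. -/
structure IsMonoidallySaturated (W : MorphismProperty V) : Prop where
  cobaseChange : W.IsStableUnderCobaseChange
  transfiniteComposition : MorphismProperty.IsStableUnderTransfiniteComposition.{v} W
  retract : W.IsStableUnderRetracts
  tensor_left (A : V) {X Y : V} (f : X ⟶ Y) : W f → W (A ◁ f)
  tensor_right (A : V) {X Y : V} (f : X ⟶ Y) : W f → W (f ▷ A)

/-- The least monoidally saturated class of maps that contains `K`. -/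
def monoidalSaturation (K : MorphismProperty V) : MorphismProperty V :=
  fun _ _ f ↦ ∀ W : MorphismProperty V, IsMonoidallySaturated W → K ≤ W → W f

variable (V) in
/-- The `⊗`-cofibrations: the monoidal saturation of the class of cofibrations. -/
def tensorCofibrations [CategoryWithCofibrations V] : MorphismProperty V :=
  monoidalSaturation (cofibrations V)

variable (V) in
/-- The class of weak equivalences is `⊗`-perfect: it is closed under filtered colimits along
`⊗`-cofibrations. -/
def IsTensorPerfect [CategoryWithCofibrations V] [CategoryWithWeakEquivalences V] : Prop :=
  ∀ (K : Type v) [SmallCategory K] [IsFiltered K] (F G : K ⥤ V) (α : F ⟶ G)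
    (cF : Cocone F) (cG : Cocone G) (_ : IsColimit cF) (_ : IsColimit cG) (f : cF.pt ⟶ cG.pt),
    (∀ ⦃j k : K⦄ (a : j ⟶ k), tensorCofibrations V (F.map a)) →
    (∀ ⦃j k : K⦄ (a : j ⟶ k), tensorCofibrations V (G.map a)) →
    (∀ k : K, WeakEquivalence (α.app k)) →
    (∀ k : K, cF.ι.app k ≫ f = α.app k ≫ cG.ι.app k) →
    WeakEquivalence f

variable (V) in
/-- A compactly generated monoidal model category. -/
structure IsCompactlyGeneratedMonoidal [ModelCategory V] : Prop where
  monoidal : IsMonoidalModelCategory V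
  cofibrantlyGenerated : IsCofibrantlyGenerated V
  small (A : V) : IsSmallRelativeTo (tensorCofibrations V) A
  perfect : IsTensorPerfect V

variable (V) in
/-- The category of `P`-algebras in `V` carries a transferred model structure: one whose
fibrations and weak equivalences are detected by the forgetful functors to `V`, one for each
colour. -/
def NSOperad.HasTransferredModelStructure [ModelCategory V] {C : Type v} (P : NSOperad.{v} C) :
    Prop :=
  ∃ _ : ModelCategory (P.Algebra V),
    (∀ ⦃A B : P.Algebra V⦄ (φ : A ⟶ B), Fibration φ ↔ ∀ c, Fibration (φ.app c)) ∧
    (∀ ⦃A B : P.Algebra V⦄ (φ : A ⟶ B), WeakEquivalence φ ↔ ∀ c, WeakEquivalence (φ.app c))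

variable (V) in
/-- An adequate monoidal model category. -/
structure IsAdequate [ModelCategory V] : Prop where
  compactlyGenerated : IsCompactlyGeneratedMonoidal V
  transferred (C : Type v) (P : NSOperad.{v} C) : P.HasTransferredModelStructure V

variable (V) in
/-- An interval: a factorisation `𝟙_ V ⨿ 𝟙_ V ⟶ H ⟶ 𝟙_ V` of the folding map into a cofibration
`(0, 1)` followed by a weak equivalence `ε`, with a monoid structure on `H` whose neutral element
is `0`, and for which `1` is absorbing (`h * 1 = ε(h) 1 = 1 * h`). -/
structure MonoidalInterval [ModelCategory V] where
  H : V
  zero : 𝟙_ V ⟶ H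
  one : 𝟙_ V ⟶ H
  ε : H ⟶ 𝟙_ V
  fac : coprod.desc zero one ≫ ε = codiag (𝟙_ V)
  cofibration : Cofibration (coprod.desc zero one)
  weakEquivalence : WeakEquivalence ε
  mul : H ⊗ H ⟶ H
  mul_assoc : mul ▷ H ≫ mul = (α_ H H H).hom ≫ H ◁ mul ≫ mul
  zero_mul : zero ▷ H ≫ mul = (λ_ H).hom
  mul_zero : H ◁ zero ≫ mul = (ρ_ H).hom
  one_mul : one ▷ H ≫ mul = (λ_ H).hom ≫ ε ≫ one
  mul_one : H ◁ one ≫ mul = (ρ_ H).hom ≫ ε ≫ one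

end ModelCategories

set_option linter.unusedSectionVars false

/-! ### The operad of an ordered monoid -/

/-! The interval is a quotient of a monoid by an ideal. Over the ordered monoid `TwoStep`, that is
{0 < 1} under multiplication, an algebra of `orderedOperad` amounts to a lax monoidal functor `A`: a
monoid M = A(1), an object U = A(0) with left and right M-actions, and an equivariant map d : U ⟶ M.
Adequacy gives a cofibrant replacement `A` of the constant algebra at I, so that M ⟶ I and U ⟶ I are
trivial fibrations.

Let H be the pushout of M ← U → I. Collapsing the ideal to a point turns that point into an
absorbing element 1, while the unit of M gives 0 (`nonempty_quotientMonoid`). The map (0,1) is a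
cobase change of (unit, d) : I ⊔ U ⟶ M, so it is a cofibration if the latter is. For ε, a path in M
from the unit to a point of U becomes a path in H from 0 to 1; multiplying by it joins the identity
of H to 1 ∘ ε. Hence 1 ∘ ε is a weak equivalence, and so is its retract ε (`weakEquivalence_ε`).

The crux is that (unit, d) is a cofibration (`cofibration_desc_unit_map`). No cell structure of free
algebras is analysed. Instead, take a diagram Q(0) ⟶ Q(1) over A, by trivial fibrations, with Q(0)
cofibrant and I ⊔ Q(0) ⟶ Q(1) a cofibration. Let N(c) be the object of elements of A(c) together
with a natural lift to Q of multiplication by that element. N is again a lax family (`lifts`), and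
the pushout-product axiom makes N ⟶ A a trivial fibration (`universalMulLift_π`). Cofibrancy of `A`
yields a multiplicative section; letting it act on the unit of Q gives a section of Q ⟶ A
(`exists_section`), which exhibits (unit, d) as a retract of a cofibration. -/

theorem heq_of_prop {p q : Prop} (h : p = q) (x : ULift.{v} (PLift p)) (y : ULift.{v} (PLift q)) :
    HEq x y := by
  subst h
  exact heq_of_eq (Subsingleton.elim _ _)

/-- The coloured operad of an ordered monoid `C`: there is at most one operation with inputs `cs`
and output `c`, and there is one if and only if the product of `cs` is at most `c`. -/
def orderedOperad (C : Type v) [Monoid C] [Preorder C] [MulLeftMono C] [MulRightMono C] :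
    NSOperad.{v} C where
  Op cs c := ULift (PLift (cs.prod ≤ c))
  one c := ⟨⟨by simp⟩⟩
  comp l r m d c f g := ⟨⟨by
    have hf := f.down.down
    simp only [List.prod_append, List.prod_cons] at hf ⊢
    exact (mul_le_mul_right (mul_le_mul_left g.down.down _) _).trans hf⟩⟩
  -- A set of operations has at most one element, so each law only compares the inequalities that
  -- index its two sides.
  one_comp g := heq_of_prop (by simp) _ _
  comp_one l r d c f := Subsingleton.elim _ _
  comp_comp l r m₁ m₂ n e d c f g h := heq_of_prop (by simp) _ _
  comp_comm l m r p q d e c f g h := heq_of_prop (by simp) _ _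

/-! ### Lax families and the algebras they define -/

section

variable {C : Type v} [Monoid C] [Preorder C] [MulLeftMono C] [MulRightMono C]
variable {V : Type u} [Category.{v} V] [MonoidalCategory V]

variable (C V) in
/-- A family of objects indexed by an ordered monoid with a unital and associative multiplication,
i.e. a lax monoidal functor on the ordered monoid. -/
structure LaxFamily where
  obj : C → V
  unit : 𝟙_ V ⟶ obj 1
  mul {c d e : C} (h : c * d ≤ e) : obj c ⊗ obj d ⟶ obj e
  unit_mul (c : C) : unit ▷ obj c ≫ mul (one_mul c).le = (λ_ (obj c)).hom
  mul_unit (c : C) : obj c ◁ unit ≫ mul (mul_one c).le = (ρ_ (obj c)).hom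
  assoc {c d e f g k : C} (h₁ : c * d ≤ f) (h₂ : f * e ≤ k) (h₃ : d * e ≤ g) (h₄ : c * g ≤ k) :
    mul h₁ ▷ obj e ≫ mul h₂ = (α_ (obj c) (obj d) (obj e)).hom ≫ obj c ◁ mul h₃ ≫ mul h₄

namespace LaxFamily

variable (A : LaxFamily C V)

/-- The transition maps of a lax family. -/
def map {c d : C} (h : c ≤ d) : A.obj c ⟶ A.obj d :=
  (ρ_ (A.obj c)).inv ≫ A.obj c ◁ A.unit ≫ A.mul ((mul_one c).le.trans h)

theorem map_rfl (c : C) (h : c ≤ c) : A.map h = 𝟙 _ := by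
  simp [map, A.mul_unit]

/-- Transition maps are right multiplication by the unit, so this is associativity with the unit as
third factor. -/
theorem mul_map {c d e k : C} (h : c * d ≤ e) (h' : e ≤ k) :
    A.mul h ≫ A.map h' = A.mul (h.trans h') := by
  have := A.assoc h ((mul_one e).le.trans h') (mul_one d).le (h.trans h')
  rw [map, rightUnitor_inv_naturality_assoc, ← whisker_exchange_assoc, this]
  simp [← whiskerLeft_comp_assoc, A.mul_unit]

theorem map_comp {c d e : C} (h : c ≤ d) (h' : d ≤ e) :
    A.map h ≫ A.map h' = A.map (h.trans h') := by
  rw [map, Category.assoc, Category.assoc, mul_map, map]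

/-- Associativity with the unit as middle factor. -/
theorem map_whiskerRight_mul {c c' d e : C} (h : c ≤ c') (h' : c' * d ≤ e) :
    A.map h ▷ A.obj d ≫ A.mul h' = A.mul ((mul_le_mul_left h d).trans h') := by
  have := A.assoc ((mul_one c).le.trans h) h' (one_mul d).le ((mul_le_mul_left h d).trans h')
  rw [map]
  simp only [comp_whiskerRight, Category.assoc, this]
  simp only [whisker_assoc, Category.assoc, Iso.inv_hom_id_assoc, ← whiskerLeft_comp_assoc,
    A.unit_mul]
  simp

theorem map_whiskerLeft_mul {c d d' e : C} (h : d ≤ d') (h' : c * d' ≤ e) :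
    A.obj c ◁ A.map h ≫ A.mul h' = A.mul ((mul_le_mul_right h c).trans h') := by
  have := A.assoc (le_refl (c * d)) ((mul_one _).le.trans ((mul_le_mul_right h c).trans h'))
    ((mul_one d).le.trans h) h'
  rw [map]
  have h2 := A.mul_map (le_refl (c * d)) ((mul_le_mul_right h c).trans h')
  rw [map, rightUnitor_inv_naturality_assoc, ← whisker_exchange_assoc, this] at h2
  rw [← h2]
  simp

/-- The multiplication of a list of factors. -/
def act : ∀ {cs : List C} {c : C} (_ : cs.prod ≤ c), listTensor A.obj cs ⟶ A.obj c
  | [], _, h => A.unit ≫ A.map (c := 1) h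
  | x :: cs, _, h => A.obj x ◁ act (le_refl cs.prod) ≫ A.mul (d := cs.prod) h

theorem act_map {cs : List C} {c d : C} (h : cs.prod ≤ c) (h' : c ≤ d) :
    A.act h ≫ A.map h' = A.act (h.trans h') := by
  cases cs with
  | nil => exact (Category.assoc _ _ _).trans (congrArg (A.unit ≫ ·) (A.map_comp _ _))
  | cons x cs =>
    exact (Category.assoc _ _ _).trans (congrArg (A.obj x ◁ A.act (le_refl cs.prod) ≫ ·)
      (A.mul_map _ _))

/-- The bound `e` for the tail is free, whereas the definition of `act` uses the exact product;
inductions need this freedom. -/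
theorem act_cons {x : C} {cs : List C} {c e : C} (h : (x :: cs).prod ≤ c) (h₁ : cs.prod ≤ e)
    (h₂ : x * e ≤ c) : A.act h = A.obj x ◁ A.act h₁ ≫ A.mul h₂ := by
  rw [← A.act_map (le_refl _) h₁, whiskerLeft_comp, Category.assoc, map_whiskerLeft_mul]
  rfl

theorem act_nil (c : C) (h : ([] : List C).prod ≤ c) :
    A.act h = A.unit ≫ A.map (c := 1) h :=
  rfl

theorem act_singleton {c d : C} (h : [c].prod ≤ d) :
    A.act h = (ρ_ (A.obj c)).hom ≫ A.map ((List.prod_singleton).ge.trans h) := by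
  have h1 : A.act (List.prod_nil.le : ([] : List C).prod ≤ 1) = A.unit := by
    exact (congrArg (A.unit ≫ ·) (A.map_rfl 1 le_rfl)).trans (Category.comp_id _)
  rw [A.act_cons h (e := 1) List.prod_nil.le h, h1, map, Iso.hom_inv_id_assoc]
  rfl

theorem _root_.listTensorAppend_cons_hom (X : C → V) (c : C) (m r : List C) :
    (listTensorAppend X (c :: m) r).hom =
      X c ◁ (listTensorAppend X m r).hom ≫ (α_ (X c) (listTensor X m) (listTensor X r)).inv :=
  rfl

theorem act_append {m r : List C} {c d e : C} (h : (m ++ r).prod ≤ e) (hm : m.prod ≤ c)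
    (hr : r.prod ≤ d) (he : c * d ≤ e) :
    A.act h = (listTensorAppend A.obj m r).hom ≫ (A.act hm ⊗ₘ A.act hr) ≫ A.mul he := by
  induction m generalizing c e with
  | nil =>
    have h1 : (1 : C) ≤ c := hm
    have h2 : d ≤ e := (one_mul d).ge.trans ((mul_le_mul_left h1 d).trans he)
    have h3 := A.map_whiskerRight_mul h1 he
    have h4 := A.mul_map (one_mul d).le h2
    simp only [listTensorAppend, listTensor, act_nil, tensorHom_def', Iso.symm_hom,
      comp_whiskerRight, Category.assoc, h3, List.nil_append]
    rw [← h4, reassoc_of% (A.unit_mul d)]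
    simp [act_map]
  | cons x m ih =>
    have h1 := mul_le_mul_left hm d
    have h2 : (m ++ r).prod ≤ m.prod * d := by
      rw [List.prod_append]; exact mul_le_mul_right hr _
    have h3 : x * (m.prod * d) ≤ e := by
      rw [← mul_assoc]; exact (mul_le_mul_left hm d).trans he
    have hm' : x * m.prod ≤ c := hm
    have := A.assoc hm' he (le_refl (m.prod * d)) h3
    rw [List.cons_append] at *
    rw [A.act_cons h h2 h3, ih h2 le_rfl le_rfl, A.act_cons hm le_rfl hm']
    rw [listTensorAppend_cons_hom]
    simp only [tensorHom_def', comp_whiskerRight, Category.assoc, whiskerLeft_comp, listTensor,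
      this]
    refine Eq.trans ?_ (Category.assoc _ _ _).symm
    simp
    rfl

theorem act_insert (l r m : List C) {d c : C} (h : (l ++ (m ++ r)).prod ≤ c)
    (hf : (l ++ d :: r).prod ≤ c) (hg : m.prod ≤ d) :
    A.act h = listTensorInsert A.obj r m (A.act hg) l ≫ A.act hf := by
  induction l generalizing c with
  | nil =>
    have h1 : d * r.prod ≤ c := hf
    refine (A.act_append (m := m) (r := r) (c := d) (d := r.prod) h hg le_rfl h1).trans ?_
    refine Eq.trans ?_ (congrArg _ (A.act_cons (x := d) hf le_rfl h1).symm)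
    rw [MonoidalCategory.tensorHom_def]
    refine Eq.trans ?_ (Category.assoc _ _ _).symm
    rw [Category.assoc]
    rfl
  | cons x l ih =>
    have h1 : x * (l ++ d :: r).prod ≤ c := hf
    have h2 : (l ++ (m ++ r)).prod ≤ (l ++ d :: r).prod := by
      simp only [List.prod_append, List.prod_cons]
      exact mul_le_mul_right (mul_le_mul_left hg _) _
    refine (A.act_cons h h2 h1).trans ?_
    refine Eq.trans ?_ (congrArg _ (A.act_cons (x := x) hf le_rfl h1).symm)
    rw [ih h2 le_rfl, whiskerLeft_comp, Category.assoc]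
    rfl

/-- The algebra given by a lax family. -/
def toAlgebra : (orderedOperad C).Algebra V where
  obj := A.obj
  act p := A.act p.down.down
  act_one c := by rw [act_singleton, map_rfl, Category.comp_id]
  act_comp l r m d c f g := A.act_insert l r m _ f.down.down g.down.down

end LaxFamily

end

/-! ### From algebras over the ordered operad back to lax families -/

section

variable {C : Type v} [Monoid C] [Preorder C] [MulLeftMono C] [MulRightMono C]
variable {V : Type u} [Category.{v} V] [MonoidalCategory V]

theorem listTensorAppend_nil_hom (X : C → V) (m : List C) :
    (listTensorAppend X m []).hom =
      eqToHom (congrArg (listTensor X) (List.append_nil m)) ≫ (ρ_ (listTensor X m)).inv := by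
  induction m with
  | nil =>
    simp only [listTensorAppend, listTensor, unitors_inv_equal, Iso.symm_hom]
    exact (Category.id_comp _).symm
  | cons x m ih =>
    rw [listTensorAppend_cons_hom, ih]
    simp [listTensor]

theorem unit_comp_binary {X U : V} (u : 𝟙_ V ⟶ U) (f : U ⊗ X ⊗ 𝟙_ V ⟶ X)
    (h : (ρ_ X).hom = ((λ_ (X ⊗ 𝟙_ V)).inv ≫ u ▷ (X ⊗ 𝟙_ V)) ≫ f) :
    u ▷ X ≫ U ◁ (ρ_ X).inv ≫ f = (λ_ X).hom := by
  rw [Category.assoc, Iso.eq_inv_comp] at h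
  rw [← whisker_exchange_assoc, ← h]
  monoidal

theorem binary_comp_binary {X Y Z F K : V} (f : X ⊗ Y ⊗ 𝟙_ V ⟶ F) (g : F ⊗ Z ⊗ 𝟙_ V ⟶ K) :
    (X ◁ (ρ_ Y).inv ≫ f) ▷ Z ≫ F ◁ (ρ_ Z).inv ≫ g =
      (α_ X Y Z).hom ≫ X ◁ Y ◁ (ρ_ Z).inv ≫
        (((X ◁ (Y ◁ (λ_ (Z ⊗ 𝟙_ V)).inv ≫ (α_ Y (𝟙_ V) (Z ⊗ 𝟙_ V)).inv) ≫
          (α_ X (Y ⊗ 𝟙_ V) (Z ⊗ 𝟙_ V)).inv) ≫ f ▷ (Z ⊗ 𝟙_ V)) ≫ g) := by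
  rw [comp_whiskerRight_assoc, ← whisker_exchange_assoc]
  simp only [← Category.assoc]
  congr 2
  monoidal

theorem whiskerLeft_unit_insert (W : V) {X Y Z K : V} (e : X = Y) (φ : Y ⟶ X ⊗ 𝟙_ V)
    (hφ : φ = eqToHom e.symm ≫ (ρ_ X).inv) (f : X ⟶ Z) (g : W ⊗ Z ⊗ 𝟙_ V ⟶ K) :
    W ◁ eqToHom e ≫ (W ◁ (φ ≫ f ▷ 𝟙_ V)) ≫ g = W ◁ f ≫ W ◁ (ρ_ Z).inv ≫ g := by
  subst e hφ
  simp

namespace NSOperad.Algebra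

variable (A : (orderedOperad C).Algebra V)

/-- The action of the operation of the ordered operad with given inputs and output. -/
def op {cs : List C} {c : C} (h : cs.prod ≤ c) : listTensor A.obj cs ⟶ A.obj c :=
  A.act (P := orderedOperad C) ⟨⟨h⟩⟩

theorem op_insert (l r m : List C) {d c : C} (h : (l ++ (m ++ r)).prod ≤ c)
    (hf : (l ++ d :: r).prod ≤ c) (hg : m.prod ≤ d) :
    A.op h = listTensorInsert A.obj r m (A.op hg) l ≫ A.op hf :=
  A.act_comp l r m (c := c) (d := d) ⟨⟨hf⟩⟩ ⟨⟨hg⟩⟩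

theorem op_singleton (c : C) (h : [c].prod ≤ c) : A.op h = (ρ_ (A.obj c)).hom :=
  A.act_one c

theorem op_cons_eqToHom {x : C} {cs cs' : List C} (e : cs = cs') {c : C}
    (h : (x :: cs).prod ≤ c) (h' : (x :: cs').prod ≤ c) :
    A.op h = A.obj x ◁ eqToHom (congrArg (listTensor A.obj) e) ≫ A.op h' := by
  subst e
  rw [eqToHom_refl, whiskerLeft_id]
  exact (Category.id_comp _).symm

/-- The nullary operation of an algebra over the ordered operad. -/
def unit : 𝟙_ V ⟶ A.obj 1 :=
  A.op (cs := []) List.prod_nil.le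

/-- The binary operations of an algebra over the ordered operad, with a unit factor. -/
def binary {c d e : C} (h : c * d ≤ e) : A.obj c ⊗ A.obj d ⊗ 𝟙_ V ⟶ A.obj e :=
  A.op (cs := [c, d]) (by simpa using h)

/-- The binary operations of an algebra over the ordered operad. -/
def mul {c d e : C} (h : c * d ≤ e) : A.obj c ⊗ A.obj d ⟶ A.obj e :=
  A.obj c ◁ (ρ_ (A.obj d)).inv ≫ A.binary h

/-- This is the insertion of the operation on the tail into the second input of a binary one. The
insertion has inputs `cs ++ []`, which is why `eqToHom` intervenes. -/
theorem op_cons {x : C} {cs : List C} {c e : C} (h : (x :: cs).prod ≤ c) (h₁ : cs.prod ≤ e)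
    (h₂ : x * e ≤ c) : A.op h = A.obj x ◁ A.op h₁ ≫ A.mul h₂ := by
  have h3 : ([x] ++ (cs ++ [])).prod ≤ c := by simpa using h
  have h4 : ([x] ++ e :: []).prod ≤ c := by simpa using h₂
  have h5 : A.op (cs := x :: (cs ++ [])) h3 =
      (A.obj x ◁ (((listTensorAppend A.obj cs []).hom : _ ⟶ listTensor A.obj cs ⊗ 𝟙_ V) ≫
        A.op h₁ ▷ 𝟙_ V)) ≫ A.binary h₂ :=
    A.op_insert [x] [] cs h3 h4 h₁
  rw [A.op_cons_eqToHom (List.append_nil cs).symm h h3, h5]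
  exact whiskerLeft_unit_insert _ _ _ (listTensorAppend_nil_hom A.obj cs) _ _

/-- The lax family underlying an algebra over the ordered operad. -/
def toLaxFamily : LaxFamily C V where
  obj := A.obj
  unit := A.unit
  mul h := A.mul h
  unit_mul c := by
    have h1 : ([] ++ ([] ++ [c])).prod ≤ c := by simp
    have h2 : ([] ++ 1 :: [c]).prod ≤ c := by simp
    have h5 : (ρ_ (A.obj c)).hom = ((λ_ (A.obj c ⊗ 𝟙_ V)).inv ≫ A.unit ▷ (A.obj c ⊗ 𝟙_ V)) ≫
        A.binary (one_mul c).le :=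
      (A.op_singleton c h1).symm.trans (A.op_insert [] [c] [] h1 h2 List.prod_nil.le)
    exact unit_comp_binary _ _ h5
  mul_unit c := by
    have h1 : ([c] ++ ([] ++ [])).prod ≤ c := by simp
    have h2 : ([c] ++ 1 :: []).prod ≤ c := by simp
    have h5 : (ρ_ (A.obj c)).hom = (A.obj c ◁ ((λ_ (𝟙_ V)).inv ≫ A.unit ▷ (𝟙_ V))) ≫
        A.binary (mul_one c).le :=
      (A.op_singleton c h1).symm.trans (A.op_insert [c] [] [] h1 h2 List.prod_nil.le)
    rw [mul, h5, ← whiskerLeft_comp_assoc, rightUnitor_inv_naturality, unitors_inv_equal]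
  assoc {c d e f g k} h₁ h₂ h₃ h₄ := by
    have k1 : ([] ++ ([c, d] ++ [e])).prod ≤ k := by
      simpa [← mul_assoc] using (mul_le_mul_left h₁ e).trans h₂
    have k2 : ([] ++ f :: [e]).prod ≤ k := by simpa using h₂
    have k3 : [c, d].prod ≤ f := by simpa using h₁
    have k4 : [d, e].prod ≤ g := by simpa using h₃
    have h5 : (((A.obj c ◁ (A.obj d ◁ (λ_ (A.obj e ⊗ 𝟙_ V)).inv ≫ (α_ _ _ _).inv)) ≫
        (α_ _ _ _).inv) ≫ A.binary h₁ ▷ (A.obj e ⊗ 𝟙_ V)) ≫ A.binary h₂ =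
          A.obj c ◁ A.binary h₃ ≫ A.mul h₄ :=
      (A.op_insert [] [e] [c, d] k1 k2 k3).symm.trans
        (A.op_cons (x := c) (cs := [d, e]) k1 k4 h₄)
    have h6 : A.obj c ◁ A.mul h₃ ≫ A.mul h₄ =
        A.obj c ◁ A.obj d ◁ (ρ_ (A.obj e)).inv ≫ A.obj c ◁ A.binary h₃ ≫ A.mul h₄ := by
      rw [← whiskerLeft_comp_assoc]; rfl
    rw [h6, ← h5]
    exact binary_comp_binary _ _

/-- The unit and the binary operations determine all others: longer lists by induction through
`op_cons`, and a nullary operation with arbitrary output by plugging the unit into a unary one. -/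
theorem op_eq_act {cs : List C} {c : C} (h : cs.prod ≤ c) :
    A.op h = A.toLaxFamily.act h := by
  induction cs generalizing c with
  | nil =>
    have h1 : ([] ++ ([] ++ [])).prod ≤ c := h
    have h2 : ([] ++ (1 : C) :: []).prod ≤ c := by simpa using h
    have h3 : (1 : C) * 1 ≤ c := by simpa using h
    have h4 : A.op h = ((λ_ (𝟙_ V)).inv ≫ A.unit ▷ 𝟙_ V) ≫ (A.obj 1 ◁ A.unit ≫ A.mul h3) :=
      (A.op_insert [] [] [] h1 h2 List.prod_nil.le).trans
        (congrArg _ (A.op_cons (x := (1 : C)) (cs := []) h2 List.prod_nil.le h3))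
    rw [h4, unitors_inv_equal, ← rightUnitor_inv_naturality, Category.assoc]
    rfl
  | cons x cs ih =>
    rw [A.op_cons h le_rfl h, ih]
    rfl

end NSOperad.Algebra

end

/-! ### Morphisms of lax families and of algebras -/

section

variable {C : Type v} [Monoid C] [Preorder C] [MulLeftMono C] [MulRightMono C]
variable {V : Type u} [Category.{v} V] [MonoidalCategory V]

theorem whiskerLeft_tensorHom_comm {X Y P Q R S W : V} (a : X ⟶ Y) {f : P ⟶ Q} {b : Q ⟶ R}
    {g : P ⟶ S} {k : S ⟶ R} (h : f ≫ b = g ≫ k) (m : Y ⊗ R ⟶ W) :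
    X ◁ f ≫ (a ⊗ₘ b) ≫ m = (a ⊗ₘ g) ≫ Y ◁ k ≫ m := by
  simp only [MonoidalCategory.tensorHom_def', Category.assoc]
  rw [← whiskerLeft_comp_assoc, h, whiskerLeft_comp_assoc, whisker_exchange_assoc]

namespace LaxFamily

/-- A family of morphisms between lax families which is compatible with the multiplications. -/
structure IsHom (A B : LaxFamily C V) (φ : ∀ c, A.obj c ⟶ B.obj c) : Prop where
  unit : A.unit ≫ φ 1 = B.unit
  mul {c d e : C} (h : c * d ≤ e) : A.mul h ≫ φ e = (φ c ⊗ₘ φ d) ≫ B.mul h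

variable {A B : LaxFamily C V} {φ : ∀ c, A.obj c ⟶ B.obj c}

theorem IsHom.map (hφ : IsHom A B φ) {c d : C} (h : c ≤ d) :
    A.map h ≫ φ d = φ c ≫ B.map h := by
  rw [LaxFamily.map, LaxFamily.map, Category.assoc, Category.assoc, hφ.mul,
    rightUnitor_inv_naturality_assoc, MonoidalCategory.tensorHom_def',
    Category.assoc, ← whiskerLeft_comp_assoc, hφ.unit, whisker_exchange_assoc]

theorem IsHom.act (hφ : IsHom A B φ) {cs : List C} {c : C} (h : cs.prod ≤ c) :
    A.act h ≫ φ c = listTensorMap φ cs ≫ B.act h := by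
  induction cs generalizing c with
  | nil =>
    have h1 : (1 : C) ≤ c := h
    have h2 : (A.unit ≫ A.map h1) ≫ φ c = 𝟙 (𝟙_ V) ≫ B.unit ≫ B.map h1 := by
      rw [Category.assoc, hφ.map, reassoc_of% hφ.unit, Category.id_comp]
    exact h2
  | cons x cs ih =>
    have h1 : x * cs.prod ≤ c := h
    rw [A.act_cons h le_rfl h1, B.act_cons h le_rfl h1]
    refine (Category.assoc _ _ _).trans ?_
    rw [hφ.mul]
    exact whiskerLeft_tensorHom_comm (φ x) (ih le_rfl) _

/-- The morphism of algebras given by a family which is compatible with the multiplications. -/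
def IsHom.toAlgebraHom {B : (orderedOperad C).Algebra V} {φ : ∀ c, A.obj c ⟶ B.obj c}
    (hφ : IsHom A B.toLaxFamily φ) : A.toAlgebra ⟶ B :=
  NSOperad.Algebra.Hom.mk φ fun p ↦
    (hφ.act p.down.down).trans (congrArg _ (B.op_eq_act p.down.down).symm)

theorem toAlgebra_unit (A : LaxFamily C V) : A.toAlgebra.unit = A.unit :=
  (congrArg (A.unit ≫ ·) (A.map_rfl 1 le_rfl)).trans (Category.comp_id _)

theorem toAlgebra_mul (A : LaxFamily C V) {c d e : C} (h : c * d ≤ e) :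
    A.toAlgebra.mul h = A.mul h := by
  have h1 : A.act (cs := [d]) List.prod_singleton.le = (ρ_ (A.obj d)).hom := by
    rw [act_singleton, map_rfl, Category.comp_id]
  have h2 : A.toAlgebra.binary h = A.obj c ◁ (ρ_ (A.obj d)).hom ≫ A.mul h :=
    (A.act_cons (x := c) (cs := [d]) (by simpa using h) List.prod_singleton.le h).trans
      (by rw [h1]; rfl)
  rw [NSOperad.Algebra.mul, h2]
  exact whiskerLeft_inv_hom_assoc _ _ _

end LaxFamily

theorem NSOperad.Algebra.isHom_app {A B : (orderedOperad C).Algebra V} (φ : A ⟶ B) :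
    LaxFamily.IsHom A.toLaxFamily B.toLaxFamily φ.app where
  unit := (φ.comm (P := orderedOperad C) ⟨⟨List.prod_nil.le⟩⟩).trans (Category.id_comp _)
  mul {c d e} h := by
    have h1 : A.binary h ≫ φ.app e = (φ.app c ⊗ₘ (φ.app d ⊗ₘ 𝟙 (𝟙_ V))) ≫ B.binary h :=
      φ.comm (P := orderedOperad C) (cs := [c, d]) ⟨⟨by simpa using h⟩⟩
    have h2 : A.mul h ≫ φ.app e = (φ.app c ⊗ₘ φ.app d) ≫ B.mul h := by
      rw [NSOperad.Algebra.mul, NSOperad.Algebra.mul, Category.assoc, h1]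
      exact whiskerLeft_tensorHom_comm _ (by simp) _
    exact h2

/-- The target stays the given lax family, so its round trip through algebras need not be identified
with it. -/
theorem LaxFamily.isHom_toAlgebra_app {A : (orderedOperad C).Algebra V} {B : LaxFamily C V}
    (φ : A ⟶ B.toAlgebra) : LaxFamily.IsHom A.toLaxFamily B φ.app where
  unit := (NSOperad.Algebra.isHom_app φ).unit.trans B.toAlgebra_unit
  mul h := ((NSOperad.Algebra.isHom_app φ).mul h).trans (congrArg _ (B.toAlgebra_mul h))

end

/-! ### Representing objects in a closed category -/

section

variable {V : Type u} [Category.{v} V] [MonoidalCategory V]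

/-- The object is the product of `A` with the internal homs from `X i` to `Y i`; adjunction
translates its universal property into maps out of tensor products. -/
theorem exists_universal_actions [HasLimits V] (hr : ∀ A : V, (tensorRight A).IsLeftAdjoint)
    (A : V) {ι : Type v} (X Y : ι → V) :
    ∃ (T : V) (π : T ⟶ A) (b : ∀ i, T ⊗ X i ⟶ Y i),
      (∀ (Z : V) (x : Z ⟶ A) (y : ∀ i, Z ⊗ X i ⟶ Y i),
        ∃ f : Z ⟶ T, f ≫ π = x ∧ ∀ i, f ▷ X i ≫ b i = y i) ∧
      (∀ (Z : V) (f g : Z ⟶ T), f ≫ π = g ≫ π → (∀ i, f ▷ X i ≫ b i = g ▷ X i ≫ b i) →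
        f = g) := by
  choose R hR using fun i ↦ (hr (X i)).exists_rightAdjoint
  let adj (i : ι) : tensorRight (X i) ⊣ R i := (hR i).some
  refine ⟨A ⨯ ∏ᶜ fun i ↦ (R i).obj (Y i), Limits.prod.fst,
    fun i ↦ (Limits.prod.snd ≫ Pi.π _ i) ▷ X i ≫ (adj i).counit.app (Y i), ?_, ?_⟩
  · intro Z x y
    refine ⟨Limits.prod.lift x (Pi.lift fun i ↦ (adj i).homEquiv _ _ (y i)),
      Limits.prod.lift_fst _ _, fun i ↦ ?_⟩
    have := (adj i).homEquiv_counit (X := Z) (Y := Y i) (g := (adj i).homEquiv _ _ (y i))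
    rw [Equiv.symm_apply_apply] at this
    rw [← comp_whiskerRight_assoc, Limits.prod.lift_snd_assoc, Pi.lift_π]
    exact this.symm
  · intro Z f g h1 h2
    apply Limits.prod.hom_ext h1
    apply Limits.Pi.hom_ext
    intro i
    apply ((adj i).homEquiv _ _).symm.injective
    have := h2 i
    rw [← comp_whiskerRight_assoc, ← comp_whiskerRight_assoc] at this
    rw [Adjunction.homEquiv_counit, Adjunction.homEquiv_counit, Category.assoc, Category.assoc]
    exact this

/-- Transposing each pair `f k`, `g k` turns the equations into an ordinary equalizer. -/
theorem exists_universal_equalizing [HasLimits V] (hr : ∀ A : V, (tensorRight A).IsLeftAdjoint)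
    (T : V) {κ : Type v} (X Y : κ → V) (f g : ∀ k, T ⊗ X k ⟶ Y k) :
    ∃ (N : V) (n : N ⟶ T), Mono n ∧ (∀ k, n ▷ X k ≫ f k = n ▷ X k ≫ g k) ∧
      (∀ (Z : V) (z : Z ⟶ T), (∀ k, z ▷ X k ≫ f k = z ▷ X k ≫ g k) →
        ∃ y : Z ⟶ N, y ≫ n = z) := by
  choose R hR using fun i ↦ (hr (X i)).exists_rightAdjoint
  let adj (i : κ) : tensorRight (X i) ⊣ R i := (hR i).some
  have key (Z : V) (z : Z ⟶ T) (k : κ) (φ : T ⊗ X k ⟶ Y k) :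
      z ≫ (adj k).homEquiv _ _ φ = (adj k).homEquiv _ _ (z ▷ X k ≫ φ) :=
    ((adj k).homEquiv_naturality_left z φ).symm
  refine ⟨equalizer (Pi.lift fun k ↦ (adj k).homEquiv _ _ (f k))
    (Pi.lift fun k ↦ (adj k).homEquiv _ _ (g k)), equalizer.ι _ _, inferInstance, ?_, ?_⟩
  · intro k
    apply ((adj k).homEquiv _ _).injective
    rw [← key, ← key]
    have := congrArg (· ≫ Pi.π _ k) (equalizer.condition
      (Pi.lift fun k ↦ (adj k).homEquiv _ _ (f k)) (Pi.lift fun k ↦ (adj k).homEquiv _ _ (g k)))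
    simpa using this
  · intro Z z h
    refine ⟨equalizer.lift z ?_, equalizer.lift_ι _ _⟩
    apply Limits.Pi.hom_ext
    intro k
    simp [key, h]

end

/-! ### Covers and universal lifts of multiplications -/

section

variable {C : Type v} [Monoid C] [Preorder C] [MulLeftMono C] [MulRightMono C]
variable {V : Type u} [Category.{v} V] [MonoidalCategory V]

/-- A diagram over (the underlying diagram of) a lax family. -/
structure LaxFamily.Cover (A : LaxFamily C V) where
  obj : C → V
  map {c d : C} (h : c ≤ d) : obj c ⟶ obj d
  map_rfl (c : C) : map (le_refl c) = 𝟙 (obj c)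
  map_comp {c d e : C} (h : c ≤ d) (h' : d ≤ e) : map h ≫ map h' = map (h.trans h')
  proj (c : C) : obj c ⟶ A.obj c
  map_proj {c d : C} (h : c ≤ d) : map h ≫ proj d = proj c ≫ A.map h

namespace LaxFamily.Cover

variable {A : LaxFamily C V} (Q : A.Cover)

/-- A lift along `Q.proj` of the multiplication by `x`, as a natural family of morphisms. -/
structure MulLift {c : C} {Z : V} (x : Z ⟶ A.obj c) where
  act {e e' : C} (h : c * e ≤ e') : Z ⊗ Q.obj e ⟶ Q.obj e'
  act_map {e e' k : C} (h : c * e ≤ e') (h' : e' ≤ k) : act h ≫ Q.map h' = act (h.trans h')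
  map_act {e e' k : C} (h : e ≤ e') (h' : c * e' ≤ k) :
    Z ◁ Q.map h ≫ act h' = act ((mul_le_mul_right h c).trans h')
  act_proj {e e' : C} (h : c * e ≤ e') : act h ≫ Q.proj e' = (x ⊗ₘ Q.proj e) ≫ A.mul h

/-- The intermediate index is immaterial: both sides factor through the least one, `c' * f`. -/
theorem MulLift.act_act {Q : A.Cover} {c c' : C} {Z Z' : V} {x : Z ⟶ A.obj c} {x' : Z' ⟶ A.obj c'}
    (L : Q.MulLift x) (L' : Q.MulLift x') {f g g' k : C} (h : c' * f ≤ g) (h' : c * g ≤ k)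
    (h₁ : c' * f ≤ g') (h₂ : c * g' ≤ k) :
    Z ◁ L'.act h ≫ L.act h' = Z ◁ L'.act h₁ ≫ L.act h₂ := by
  rw [← L'.act_map le_rfl h, ← L'.act_map le_rfl h₁, whiskerLeft_comp_assoc,
    whiskerLeft_comp_assoc, L.map_act, L.map_act]

/-- The universal lift. -/
structure UniversalMulLift (c : C) where
  obj : V
  π : obj ⟶ A.obj c
  lift : Q.MulLift π
  exists_desc {Z : V} {x : Z ⟶ A.obj c} (L : Q.MulLift x) :
    ∃ f : Z ⟶ obj, f ≫ π = x ∧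
      ∀ {e e' : C} (h : c * e ≤ e'), f ▷ Q.obj e ≫ lift.act h = L.act h
  hom_ext {Z : V} {f g : Z ⟶ obj} (h₁ : f ≫ π = g ≫ π)
    (h₂ : ∀ {e e' : C} (h : c * e ≤ e'), f ▷ Q.obj e ≫ lift.act h = g ▷ Q.obj e ≫ lift.act h) :
    f = g

theorem nonempty_universalMulLift [HasLimits V] (hr : ∀ A : V, (tensorRight A).IsLeftAdjoint)
    (c : C) : Nonempty (Q.UniversalMulLift c) := by
  obtain ⟨T, π, b, hb, hT⟩ := exists_universal_actions hr (A.obj c)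
    (ι := {t : C × C // c * t.1 ≤ t.2}) (fun t ↦ Q.obj t.1.1) (fun t ↦ Q.obj t.1.2)
  let b' {e e' : C} (h : c * e ≤ e') : T ⊗ Q.obj e ⟶ Q.obj e' := b ⟨(e, e'), h⟩
  -- Starting from arbitrary families of actions, three successive equalizers impose naturality in
  -- the target, naturality in the source, and compatibility with the projection.
  obtain ⟨N₁, n₁, _, h₁, hN₁⟩ := exists_universal_equalizing hr T
    (κ := {t : C × C × C // c * t.1 ≤ t.2.1 ∧ t.2.1 ≤ t.2.2}) (fun t ↦ Q.obj t.1.1)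
    (fun t ↦ Q.obj t.1.2.2) (fun t ↦ b' t.2.1 ≫ Q.map t.2.2) (fun t ↦ b' (t.2.1.trans t.2.2))
  obtain ⟨N₂, n₂, _, h₂, hN₂⟩ := exists_universal_equalizing hr N₁
    (κ := {t : C × C × C // t.1 ≤ t.2.1 ∧ c * t.2.1 ≤ t.2.2}) (fun t ↦ Q.obj t.1.1)
    (fun t ↦ Q.obj t.1.2.2) (fun t ↦ N₁ ◁ Q.map t.2.1 ≫ n₁ ▷ _ ≫ b' t.2.2)
    (fun t ↦ n₁ ▷ _ ≫ b' ((mul_le_mul_right t.2.1 c).trans t.2.2))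
  obtain ⟨N₃, n₃, _, h₃, hN₃⟩ := exists_universal_equalizing hr N₂
    (κ := {t : C × C // c * t.1 ≤ t.2}) (fun t ↦ Q.obj t.1.1) (fun t ↦ A.obj t.1.2)
    (fun t ↦ (n₂ ≫ n₁) ▷ _ ≫ b' t.2 ≫ Q.proj _)
    (fun t ↦ (n₂ ≫ n₁ ≫ π) ▷ _ ≫ A.obj c ◁ Q.proj _ ≫ A.mul t.2)
  refine ⟨⟨N₃, n₃ ≫ n₂ ≫ n₁ ≫ π, ⟨fun h ↦ (n₃ ≫ n₂ ≫ n₁) ▷ _ ≫ b' h, ?_, ?_, ?_⟩, ?_, ?_⟩⟩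
  · intro e e' k h h'
    have := h₁ ⟨(e, e', k), h, h'⟩
    simp only [comp_whiskerRight, Category.assoc] at this ⊢
    rw [this]
  · intro e e' k h h'
    have := h₂ ⟨(e, e', k), h, h'⟩
    simp only [comp_whiskerRight, Category.assoc] at this ⊢
    rw [← this, whisker_exchange_assoc, whisker_exchange_assoc]
  · intro e e' h
    have := h₃ ⟨(e, e'), h⟩
    simp only [comp_whiskerRight, Category.assoc, MonoidalCategory.tensorHom_def] at this ⊢
    rw [this]
  · intro Z x L
    obtain ⟨f, hf, hf'⟩ := hb Z x fun t ↦ L.act t.2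
    have hf' {e e' : C} (h : c * e ≤ e') : f ▷ _ ≫ b' h = L.act h := hf' ⟨(e, e'), h⟩
    obtain ⟨f₁, hf₁⟩ := hN₁ Z f (by
      rintro ⟨⟨e, e', k⟩, h, h'⟩
      simp only [reassoc_of% hf', hf', L.act_map])
    obtain ⟨f₂, hf₂⟩ := hN₂ Z f₁ (by
      rintro ⟨⟨e, e', k⟩, h, h'⟩
      simp only [← whisker_exchange_assoc, ← comp_whiskerRight_assoc, hf₁, hf', L.map_act])
    obtain ⟨f₃, hf₃⟩ := hN₃ Z f₂ (by
      rintro ⟨⟨e, e'⟩, h⟩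
      simp only [← comp_whiskerRight_assoc, reassoc_of% hf₂, hf₁, reassoc_of% hf₁,
        reassoc_of% hf', L.act_proj, hf, MonoidalCategory.tensorHom_def, Category.assoc])
    have : f₃ ≫ n₃ ≫ n₂ ≫ n₁ = f := by rw [reassoc_of% hf₃, reassoc_of% hf₂, hf₁]
    refine ⟨f₃, ?_, fun h ↦ ?_⟩
    · rw [reassoc_of% hf₃, reassoc_of% hf₂, reassoc_of% hf₁, hf]
    · rw [← comp_whiskerRight_assoc, this, hf']
  · intro Z f g k₁ k₂
    rw [← cancel_mono n₃, ← cancel_mono n₂, ← cancel_mono n₁]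
    apply hT
    · simpa using k₁
    · rintro ⟨⟨e, e'⟩, h⟩
      simpa [b'] using k₂ h

end LaxFamily.Cover

end

/-! ### The lax family of universal lifts -/

section

variable {C : Type v} [Monoid C] [Preorder C] [MulLeftMono C] [MulRightMono C]
variable {V : Type u} [Category.{v} V] [MonoidalCategory V]

namespace LaxFamily

theorem unit_whiskerRight_mul (A : LaxFamily C V) {c d : C} (h : 1 * c ≤ d) :
    A.unit ▷ A.obj c ≫ A.mul h = (λ_ (A.obj c)).hom ≫ A.map ((one_mul c).ge.trans h) := by
  rw [← A.mul_map (one_mul c).le ((one_mul c).ge.trans h), reassoc_of% A.unit_mul]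

theorem tensorHom_mul_assoc (A : LaxFamily C V) {c d e f g k : C} (h₁ : c * d ≤ f)
    (h₂ : f * e ≤ k) (h₃ : d * e ≤ g) (h₄ : c * g ≤ k) {X Y Z : V} (x : X ⟶ A.obj c)
    (y : Y ⟶ A.obj d) (z : Z ⟶ A.obj e) :
    ((x ⊗ₘ y) ≫ A.mul h₁ ⊗ₘ z) ≫ A.mul h₂ =
      (α_ X Y Z).hom ≫ (x ⊗ₘ ((y ⊗ₘ z) ≫ A.mul h₃)) ≫ A.mul h₄ := by
  have h₅ : ((x ⊗ₘ y) ≫ A.mul h₁ ⊗ₘ z) = ((x ⊗ₘ y) ⊗ₘ z) ≫ A.mul h₁ ▷ A.obj e := by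
    rw [← tensorHom_id, tensorHom_comp_tensorHom, Category.comp_id]
  have h₆ : (x ⊗ₘ ((y ⊗ₘ z) ≫ A.mul h₃)) = (x ⊗ₘ (y ⊗ₘ z)) ≫ A.obj c ◁ A.mul h₃ := by
    rw [← id_tensorHom, tensorHom_comp_tensorHom, Category.comp_id]
  rw [h₅, h₆, Category.assoc, Category.assoc, A.assoc h₁ h₂ h₃ h₄, associator_naturality_assoc]

theorem tensorHom_unit_mul (A : LaxFamily C V) {c : C} {X Y : V} (u : X ⟶ 𝟙_ V)
    (x : Y ⟶ A.obj c) :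
    (u ≫ A.unit ⊗ₘ x) ≫ A.mul (one_mul c).le = (u ⊗ₘ x) ≫ (λ_ _).hom := by
  rw [← A.unit_mul, ← tensorHom_id, tensorHom_comp_tensorHom_assoc, Category.comp_id]

theorem tensorHom_mul_unit (A : LaxFamily C V) {c : C} {X Y : V} (u : X ⟶ 𝟙_ V)
    (x : Y ⟶ A.obj c) :
    (x ⊗ₘ (u ≫ A.unit)) ≫ A.mul (mul_one c).le = (x ⊗ₘ u) ≫ (ρ_ _).hom := by
  rw [← A.mul_unit, ← id_tensorHom, tensorHom_comp_tensorHom_assoc, Category.comp_id]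

namespace Cover

variable {A : LaxFamily C V} {Q : A.Cover}

/-- The product of two lifts. -/
def MulLift.mul {c d k : C} {Z Z' : V} {x : Z ⟶ A.obj c} {y : Z' ⟶ A.obj d}
    (L : Q.MulLift x) (L' : Q.MulLift y) (hk : c * d ≤ k) :
    Q.MulLift ((x ⊗ₘ y) ≫ A.mul hk) where
  act {e e'} h := (α_ _ _ _).hom ≫ Z ◁ L'.act le_rfl ≫
    L.act (e := d * e) ((mul_assoc c d e).ge.trans ((mul_le_mul_left hk e).trans h))
  act_map h h' := by simp only [Category.assoc, L.act_map]
  map_act {e e' k'} h h' := by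
    rw [associator_naturality_right_assoc, ← whiskerLeft_comp_assoc, L'.map_act]
    congr 1
    exact L.act_act L' _ _ _ _
  act_proj {e e'} h := by
    have h₁ := (mul_assoc c d e).ge.trans ((mul_le_mul_left hk e).trans h)
    have h₂ : Z ◁ L'.act (le_refl (d * e)) ≫ (x ⊗ₘ Q.proj (d * e)) =
        (x ⊗ₘ ((y ⊗ₘ Q.proj e) ≫ A.mul le_rfl)) := by
      rw [← L'.act_proj, ← id_tensorHom, tensorHom_comp_tensorHom, Category.id_comp]
    simp only [Category.assoc, L.act_proj]
    rw [reassoc_of% h₂, A.tensorHom_mul_assoc hk h le_rfl h₁]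

/-- Multiplication by the unit. -/
def MulLift.unit (Q : A.Cover) : Q.MulLift A.unit where
  act {e e'} h := (λ_ _).hom ≫ Q.map ((one_mul e).ge.trans h)
  act_map h h' := by rw [Category.assoc, Q.map_comp]
  map_act h h' := by rw [leftUnitor_naturality_assoc, Q.map_comp]
  act_proj h := by
    rw [Category.assoc, Q.map_proj, MonoidalCategory.tensorHom_def', Category.assoc,
      A.unit_whiskerRight_mul, leftUnitor_naturality_assoc]

variable (N : ∀ c, Q.UniversalMulLift c)

/-- Lifts compose, so the universal property yields the product; it acts on `Q` as the composite of
the two actions, through any intermediate index `l`. -/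
theorem exists_mul {c d e : C} (h : c * d ≤ e) : ∃ m : (N c).obj ⊗ (N d).obj ⟶ (N e).obj,
    m ≫ (N e).π = ((N c).π ⊗ₘ (N d).π) ≫ A.mul h ∧
    ∀ {f k l : C} (h₁ : e * f ≤ k) (h₂ : d * f ≤ l) (h₃ : c * l ≤ k),
      m ▷ Q.obj f ≫ (N e).lift.act h₁ =
        (α_ _ _ _).hom ≫ (N c).obj ◁ (N d).lift.act h₂ ≫ (N c).lift.act h₃ := by
  obtain ⟨m, h₁, h₂⟩ := (N e).exists_desc ((N c).lift.mul (N d).lift h)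
  refine ⟨m, h₁, fun h₃ h₄ h₅ ↦ (h₂ h₃).trans ?_⟩
  exact congrArg _ ((N c).lift.act_act (N d).lift _ _ _ _)

theorem exists_unit : ∃ m : 𝟙_ V ⟶ (N 1).obj,
    m ≫ (N 1).π = A.unit ∧
    ∀ {e k : C} (h₁ : 1 * e ≤ k),
      m ▷ Q.obj e ≫ (N 1).lift.act h₁ = (λ_ _).hom ≫ Q.map ((one_mul e).ge.trans h₁) :=
  (N 1).exists_desc (.unit Q)

/-- The lax family of universal lifts. -/
noncomputable def lifts : LaxFamily C V where
  obj c := (N c).obj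
  unit := (exists_unit N).choose
  mul h := (exists_mul N h).choose
  unit_mul c := by
    obtain ⟨h₁, h₂⟩ := (exists_unit N).choose_spec
    obtain ⟨h₃, h₄⟩ := (exists_mul N (one_mul c).le).choose_spec
    apply (N c).hom_ext
    · rw [Category.assoc, h₃, whiskerRight_comp_tensorHom_assoc, h₁]
      simpa using A.tensorHom_unit_mul (𝟙 _) (N c).π
    · intro e e' h
      rw [comp_whiskerRight_assoc, h₄ h h ((one_mul _).le), associator_naturality_left_assoc,
        ← whisker_exchange_assoc, h₂, Q.map_rfl, Category.comp_id]
      simp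
  mul_unit c := by
    obtain ⟨h₁, h₂⟩ := (exists_unit N).choose_spec
    obtain ⟨h₃, h₄⟩ := (exists_mul N (mul_one c).le).choose_spec
    apply (N c).hom_ext
    · rw [Category.assoc, h₃, whiskerLeft_comp_tensorHom_assoc, h₁]
      simpa using A.tensorHom_mul_unit (𝟙 _) (N c).π
    · intro e e' h
      rw [comp_whiskerRight_assoc, h₄ h (one_mul e).le h, associator_naturality_middle_assoc,
        ← whiskerLeft_comp_assoc, h₂, Q.map_rfl, Category.comp_id]
      simp
  assoc {c d e f g k} k₁ k₂ k₃ k₄ := by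
    obtain ⟨h₁, h₁'⟩ := (exists_mul N k₁).choose_spec
    obtain ⟨h₂, h₂'⟩ := (exists_mul N k₂).choose_spec
    obtain ⟨h₃, h₃'⟩ := (exists_mul N k₃).choose_spec
    obtain ⟨h₄, h₄'⟩ := (exists_mul N k₄).choose_spec
    apply (N k).hom_ext
    · rw [Category.assoc, h₂, whiskerRight_comp_tensorHom_assoc, h₁, A.tensorHom_mul_assoc k₁ k₂ k₃ k₄,
        Category.assoc, Category.assoc, h₄, whiskerLeft_comp_tensorHom_assoc, h₃]
    · intro a b h
      have k₅ : c * (g * a) ≤ b :=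
        (mul_assoc c g a).ge.trans ((mul_le_mul_left k₄ a).trans h)
      have k₆ : f * (e * a) ≤ b :=
        (mul_assoc f e a).ge.trans ((mul_le_mul_left k₂ a).trans h)
      have k₇ : d * (e * a) ≤ g * a := (mul_assoc d e a).ge.trans (mul_le_mul_left k₃ a)
      rw [comp_whiskerRight_assoc, h₂' h le_rfl k₆, associator_naturality_left_assoc,
        ← whisker_exchange_assoc, h₁' k₆ k₇ k₅]
      simp only [comp_whiskerRight, Category.assoc]
      rw [h₄' h le_rfl k₅, associator_naturality_middle_assoc, ← whiskerLeft_comp_assoc,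
        h₃' le_rfl le_rfl k₇]
      simp

theorem isHom_lifts_π : IsHom (lifts N) A (fun c ↦ (N c).π) where
  unit := (exists_unit N).choose_spec.1
  mul h := (exists_mul N h).choose_spec.1

theorem lifts_mul_act {c d e : C} (h : c * d ≤ e) {f k l : C} (h₁ : e * f ≤ k)
    (h₂ : d * f ≤ l) (h₃ : c * l ≤ k) :
    (lifts N).mul h ▷ Q.obj f ≫ (N e).lift.act h₁ =
      (α_ _ _ _).hom ≫ (N c).obj ◁ (N d).lift.act h₂ ≫ (N c).lift.act h₃ :=
  (exists_mul N h).choose_spec.2 h₁ h₂ h₃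

theorem lifts_unit_act {e k : C} (h₁ : 1 * e ≤ k) :
    (lifts N).unit ▷ Q.obj e ≫ (N 1).lift.act h₁ =
      (λ_ _).hom ≫ Q.map ((one_mul e).ge.trans h₁) :=
  (exists_unit N).choose_spec.2 h₁

end Cover

end LaxFamily

end

/-! ### Sections of a cover from multiplicative sections -/

section

variable {C : Type v} [Monoid C] [Preorder C] [MulLeftMono C] [MulRightMono C]
variable {V : Type u} [Category.{v} V] [MonoidalCategory V]

namespace LaxFamily.Cover

variable {A : LaxFamily C V} {Q : A.Cover} (N : ∀ c, Q.UniversalMulLift c)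

theorem lifts_map_act {c d : C} (h : c ≤ d) {f k : C} (h₁ : d * f ≤ k) :
    ((lifts N).map h : (N c).obj ⟶ (N d).obj) ▷ Q.obj f ≫ (N d).lift.act h₁ =
      (N c).lift.act ((mul_le_mul_left h f).trans h₁) := by
  let u : 𝟙_ V ⟶ (N 1).obj := (lifts N).unit
  let m : (N c).obj ⊗ (N 1).obj ⟶ (N d).obj := (lifts N).mul ((mul_one c).le.trans h)
  have hu : u ▷ Q.obj f ≫ _ = _ := lifts_unit_act N (one_mul f).le
  have hm : m ▷ Q.obj f ≫ _ = _ :=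
    lifts_mul_act N ((mul_one c).le.trans h) h₁ (one_mul f).le ((mul_le_mul_left h f).trans h₁)
  change ((ρ_ (N c).obj).inv ≫ (N c).obj ◁ u ≫ m) ▷ Q.obj f ≫ _ = _
  simp only [comp_whiskerRight, Category.assoc]
  rw [hm, associator_naturality_middle_assoc, ← whiskerLeft_comp_assoc, hu, Q.map_rfl,
    Category.comp_id]
  simp

/-- A multiplicative section of the projection of the universal lifts provides a section of the
covering diagram, with a prescribed value at the unit. -/
theorem exists_section {σ : ∀ c, A.obj c ⟶ (N c).obj} (hσ : IsHom A (lifts N) σ)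
    (hπ : ∀ c, σ c ≫ (N c).π = 𝟙 _) (q : 𝟙_ V ⟶ Q.obj 1) (hq : q ≫ Q.proj 1 = A.unit) :
    ∃ s : ∀ c, A.obj c ⟶ Q.obj c, (∀ c, s c ≫ Q.proj c = 𝟙 _) ∧ A.unit ≫ s 1 = q ∧
      ∀ {c d : C} (h : c ≤ d), A.map h ≫ s d = s c ≫ Q.map h := by
  let u : 𝟙_ V ⟶ (N 1).obj := (lifts N).unit
  let m {c d : C} (h : c ≤ d) : (N c).obj ⟶ (N d).obj := (lifts N).map h
  have hu : A.unit ≫ σ 1 = u := hσ.unit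
  have hu' : u ▷ Q.obj 1 ≫ _ = _ := lifts_unit_act N (one_mul 1).le
  have hm {c d : C} (h : c ≤ d) : A.map h ≫ σ d = σ c ≫ m h := hσ.map h
  have hm' {c d : C} (h : c ≤ d) : m h ▷ Q.obj 1 ≫ _ = _ :=
    lifts_map_act N h (mul_one d).le
  -- The section sends `x` to the action of `σ x` on the point `q`, which lies over the unit.
  refine ⟨fun c ↦ (ρ_ _).inv ≫ (σ c ⊗ₘ q) ≫ (N c).lift.act (mul_one c).le, fun c ↦ ?_, ?_,
    fun {c d} h ↦ ?_⟩
  · rw [Category.assoc, Category.assoc, (N c).lift.act_proj, tensorHom_comp_tensorHom_assoc,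
      hπ, hq, id_tensorHom, A.mul_unit, Iso.inv_hom_id]
  · rw [rightUnitor_inv_naturality_assoc, whiskerRight_comp_tensorHom_assoc, hu,
      MonoidalCategory.tensorHom_def', Category.assoc, hu', Q.map_rfl,
      Category.comp_id, leftUnitor_naturality, ← unitors_inv_equal, Iso.inv_hom_id_assoc]
  · rw [rightUnitor_inv_naturality_assoc, whiskerRight_comp_tensorHom_assoc, hm,
      Category.assoc, Category.assoc, (N c).lift.act_map, MonoidalCategory.tensorHom_def',
      comp_whiskerRight, Category.assoc, Category.assoc, hm',
      MonoidalCategory.tensorHom_def', Category.assoc]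

end LaxFamily.Cover

end

/-! ### The two-element ordered monoid -/

/-- The ordered monoid with two elements `0 < 1`. -/
abbrev TwoStep : Type v := WithZero PUnit.{v + 1}

theorem TwoStep.eq_zero_or_eq_one (c : TwoStep.{v}) : c = 0 ∨ c = 1 := by
  cases c with
  | none => exact Or.inl rfl
  | some => exact Or.inr rfl

theorem TwoStep.le_one (c : TwoStep.{v}) : c ≤ 1 := by
  obtain rfl | rfl := c.eq_zero_or_eq_one <;> simp

theorem TwoStep.not_one_le_zero : ¬ (1 : TwoStep.{v}) ≤ 0 := by
  simp

/-! ### Collapsing an ideal to an absorbing element -/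

section

variable {V : Type u} [Category.{v} V] [MonoidalCategory V]

variable (V) in
/-- An augmented monoid `M` with an ideal `U ⟶ M`. -/
structure AugmentedIdeal where
  M : V
  U : V
  unit : 𝟙_ V ⟶ M
  mul : M ⊗ M ⟶ M
  left : M ⊗ U ⟶ U
  right : U ⊗ M ⟶ U
  d : U ⟶ M
  aug : M ⟶ 𝟙_ V
  augU : U ⟶ 𝟙_ V
  unit_mul : unit ▷ M ≫ mul = (λ_ M).hom
  mul_unit : M ◁ unit ≫ mul = (ρ_ M).hom
  assoc : mul ▷ M ≫ mul = (α_ M M M).hom ≫ M ◁ mul ≫ mul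
  left_d : left ≫ d = M ◁ d ≫ mul
  right_d : right ≫ d = d ▷ M ≫ mul
  unit_aug : unit ≫ aug = 𝟙 _
  mul_aug : mul ≫ aug = (aug ⊗ₘ aug) ≫ (λ_ _).hom
  left_aug : left ≫ augU = (aug ⊗ₘ augU) ≫ (λ_ _).hom
  right_aug : right ≫ augU = (augU ⊗ₘ aug) ≫ (λ_ _).hom
  d_aug : d ≫ aug = augU

namespace AugmentedIdeal

/-- A monoid with an absorbing element, and its augmentation. -/
structure QuotientMonoid (D : AugmentedIdeal V) {H : V} (inl : D.M ⟶ H) (one : 𝟙_ V ⟶ H) where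
  ε : H ⟶ 𝟙_ V
  mul : H ⊗ H ⟶ H
  inl_ε : inl ≫ ε = D.aug
  one_ε : one ≫ ε = 𝟙 _
  mul_assoc : mul ▷ H ≫ mul = (α_ H H H).hom ≫ H ◁ mul ≫ mul
  zero_mul : (D.unit ≫ inl) ▷ H ≫ mul = (λ_ H).hom
  mul_zero : H ◁ (D.unit ≫ inl) ≫ mul = (ρ_ H).hom
  one_mul : one ▷ H ≫ mul = (λ_ H).hom ≫ ε ≫ one
  mul_one : H ◁ one ≫ mul = (ρ_ H).hom ≫ ε ≫ one

/-- Tensoring preserves the pushout in each variable, so the product is defined one variable at a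
time and every law is checked on the summands `M` and `I`. The two actions on `U` make the
definitions descend. -/
theorem nonempty_quotientMonoid (D : AugmentedIdeal V)
    (hl : ∀ A : V, (tensorLeft A).IsLeftAdjoint) (hr : ∀ A : V, (tensorRight A).IsLeftAdjoint)
    {H : V} {inl : D.M ⟶ H} {one : 𝟙_ V ⟶ H} (hp : IsPushout D.d D.augU inl one) :
    Nonempty (D.QuotientMonoid inl one) := by
  have hL (X : V) : IsPushout (X ◁ D.d) (X ◁ D.augU) (X ◁ inl) (X ◁ one) :=
    hp.map (tensorLeft X)
  have hR (X : V) : IsPushout (D.d ▷ X) (D.augU ▷ X) (inl ▷ X) (one ▷ X) :=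
    hp.map (tensorRight X)
  obtain ⟨ε, hε₁, hε₂⟩ : ∃ ε : H ⟶ 𝟙_ V, inl ≫ ε = D.aug ∧ one ≫ ε = 𝟙 _ :=
    ⟨hp.desc D.aug (𝟙 _) (by rw [D.d_aug, Category.comp_id]), hp.inl_desc _ _ _,
      hp.inr_desc _ _ _⟩
  obtain ⟨f, hf₁, hf₂⟩ : ∃ f : D.M ⊗ H ⟶ H, D.M ◁ inl ≫ f = D.mul ≫ inl ∧
      D.M ◁ one ≫ f = (ρ_ _).hom ≫ D.aug ≫ one :=
    ⟨(hL D.M).desc (D.mul ≫ inl) ((ρ_ _).hom ≫ D.aug ≫ one) (by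
      rw [← reassoc_of% D.left_d, hp.w, reassoc_of% D.left_aug, MonoidalCategory.tensorHom_def',
        unitors_equal, Category.assoc, rightUnitor_naturality_assoc]),
      (hL D.M).inl_desc _ _ _, (hL D.M).inr_desc _ _ _⟩
  obtain ⟨μ, hμ₁, hμ₂⟩ : ∃ μ : H ⊗ H ⟶ H, inl ▷ H ≫ μ = f ∧
      one ▷ H ≫ μ = (λ_ _).hom ≫ ε ≫ one :=
    ⟨(hR H).desc f ((λ_ _).hom ≫ ε ≫ one) (by
      apply (hL D.U).hom_ext
      · rw [whisker_exchange_assoc, hf₁, ← reassoc_of% D.right_d, hp.w, reassoc_of% D.right_aug,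
          whisker_exchange_assoc, leftUnitor_naturality_assoc, reassoc_of% hε₁,
          MonoidalCategory.tensorHom_def, Category.assoc, leftUnitor_naturality_assoc]
      · rw [whisker_exchange_assoc, hf₂, whisker_exchange_assoc, leftUnitor_naturality_assoc,
          reassoc_of% hε₂, rightUnitor_naturality_assoc, reassoc_of% D.d_aug, unitors_equal,
          rightUnitor_naturality_assoc]),
      (hR H).inl_desc _ _ _, (hR H).inr_desc _ _ _⟩
  have mul_one : H ◁ one ≫ μ = (ρ_ H).hom ≫ ε ≫ one := by
    apply (hR _).hom_ext
    · rw [← whisker_exchange_assoc, hμ₁, hf₂, rightUnitor_naturality_assoc, reassoc_of% hε₁]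
    · rw [← whisker_exchange_assoc, hμ₂, leftUnitor_naturality_assoc,
        rightUnitor_naturality_assoc, unitors_equal]
  -- Multiplicativity of the augmentation is what associativity requires when the first factor is
  -- the absorbing element.
  have hμε : μ ≫ ε = (ε ⊗ₘ ε) ≫ (λ_ _).hom := by
    apply (hR _).hom_ext
    · rw [reassoc_of% hμ₁, whiskerRight_comp_tensorHom_assoc, hε₁]
      apply (hL _).hom_ext
      · rw [reassoc_of% hf₁, hε₁, whiskerLeft_comp_tensorHom_assoc, hε₁, D.mul_aug]
      · rw [reassoc_of% hf₂, hε₂, whiskerLeft_comp_tensorHom_assoc, hε₂]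
        simp [unitors_equal]
    · rw [reassoc_of% hμ₂, whiskerRight_comp_tensorHom_assoc, hε₂]
      simp
  have mul_assoc : μ ▷ H ≫ μ = (α_ H H H).hom ≫ H ◁ μ ≫ μ := by
    have hR' (X Y : V) : IsPushout (D.d ▷ X ▷ Y) (D.augU ▷ X ▷ Y) (inl ▷ X ▷ Y) (one ▷ X ▷ Y) :=
      (hR X).map (tensorRight Y)
    have hLR (X Y : V) :
        IsPushout ((X ◁ D.d) ▷ Y) ((X ◁ D.augU) ▷ Y) ((X ◁ inl) ▷ Y) ((X ◁ one) ▷ Y) :=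
      (hL X).map (tensorRight Y)
    apply (hR' _ _).hom_ext
    · have h₁ : inl ▷ H ▷ H ≫ μ ▷ H ≫ μ = f ▷ H ≫ μ := by
        rw [← comp_whiskerRight_assoc, hμ₁]
      have h₂ : inl ▷ H ▷ H ≫ (α_ H H H).hom ≫ H ◁ μ ≫ μ = (α_ _ _ _).hom ≫ D.M ◁ μ ≫ f := by
        rw [associator_naturality_left_assoc, ← whisker_exchange_assoc, hμ₁]
      rw [h₁, h₂]
      apply (hLR _ _).hom_ext
      · rw [← comp_whiskerRight_assoc, hf₁, comp_whiskerRight_assoc, hμ₁,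
          associator_naturality_middle_assoc, ← whiskerLeft_comp_assoc, hμ₁]
        apply (hL _).hom_ext
        · rw [whisker_exchange_assoc, hf₁, reassoc_of% D.assoc, associator_naturality_right_assoc,
            ← whiskerLeft_comp_assoc, hf₁, whiskerLeft_comp_assoc, hf₁]
        · rw [whisker_exchange_assoc, hf₂, rightUnitor_naturality_assoc, reassoc_of% D.mul_aug,
            associator_naturality_right_assoc, ← whiskerLeft_comp_assoc, hf₂]
          simp only [whiskerLeft_comp, Category.assoc, hf₂]
          rw [MonoidalCategory.tensorHom_def', unitors_equal, Category.assoc,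
            rightUnitor_naturality_assoc]
          simp
      · rw [← comp_whiskerRight_assoc, hf₂, associator_naturality_middle_assoc,
          ← whiskerLeft_comp_assoc, hμ₂]
        simp only [whiskerLeft_comp, comp_whiskerRight, Category.assoc, hμ₂, hf₂]
        rw [← rightUnitor_naturality_assoc, whisker_exchange_assoc, ← unitors_equal,
          leftUnitor_naturality_assoc]
        simp
    · have h₁ : one ▷ H ▷ H ≫ μ ▷ H ≫ μ = (λ_ _).hom ▷ H ≫ (ε ⊗ₘ ε) ≫ (λ_ _).hom ≫ one := by
        rw [← comp_whiskerRight_assoc, hμ₂]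
        simp only [comp_whiskerRight, Category.assoc, hμ₂]
        rw [MonoidalCategory.tensorHom_def, Category.assoc, leftUnitor_naturality_assoc]
      rw [h₁, associator_naturality_left_assoc, ← whisker_exchange_assoc, hμ₂,
        leftUnitor_naturality_assoc, reassoc_of% hμε]
      simp

  refine ⟨⟨ε, μ, hε₁, hε₂, mul_assoc, ?_, ?_, hμ₂, mul_one⟩⟩
  · rw [comp_whiskerRight, Category.assoc, hμ₁]
    apply (hL _).hom_ext
    · rw [whisker_exchange_assoc, hf₁, reassoc_of% D.unit_mul, leftUnitor_naturality]
    · rw [whisker_exchange_assoc, hf₂, rightUnitor_naturality_assoc, reassoc_of% D.unit_aug,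
        leftUnitor_naturality, unitors_equal]
  · apply (hR _).hom_ext
    · rw [← whisker_exchange_assoc, hμ₁, whiskerLeft_comp_assoc, hf₁, reassoc_of% D.mul_unit,
        rightUnitor_naturality]
    · rw [← whisker_exchange_assoc, hμ₂, leftUnitor_naturality_assoc, Category.assoc,
        reassoc_of% hε₁, reassoc_of% D.unit_aug, rightUnitor_naturality, unitors_equal]

end AugmentedIdeal

end

/-! ### Lifting through the pushout-product axiom -/

section

variable {V : Type u} [Category.{v} V] [MonoidalCategory V] [ModelCategory V]

namespace IsMonoidalModelCategory

theorem isInitial_tensor (hV : IsMonoidalModelCategory V) (X : V) : Nonempty (IsInitial (X ⊗ ⊥_ V)) := by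
  have := hV.closed_left X
  exact ⟨IsInitial.isInitialObj (tensorLeft X) _ initialIsInitial⟩

theorem tensor_isInitial (hV : IsMonoidalModelCategory V) (X : V) : Nonempty (IsInitial ((⊥_ V) ⊗ X)) := by
  have := hV.closed_right X
  exact ⟨IsInitial.isInitialObj (tensorRight X) _ initialIsInitial⟩

/-- The lifting property expressed by the pushout-product axiom. -/
theorem exists_lift (hV : IsMonoidalModelCategory V) {Z W X Y E B : V}
    (i : Z ⟶ W) (g : X ⟶ Y) (p : E ⟶ B) [Cofibration i]
    [Cofibration g] [Fibration p] [WeakEquivalence p] {a : Z ⊗ Y ⟶ E} {b : W ⊗ X ⟶ E}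
    (h : Z ◁ g ≫ a = i ▷ X ≫ b) {w : W ⊗ Y ⟶ B} (ha : a ≫ p = i ▷ Y ≫ w)
    (hb : b ≫ p = W ◁ g ≫ w) :
    ∃ l : W ⊗ Y ⟶ E, i ▷ Y ≫ l = a ∧ W ◁ g ≫ l = b ∧ l ≫ p = w := by
  have := (hV.pushoutProduct i g).1
  have h₁ : pushout.inl _ _ ≫ pushoutProductMap i g = i ▷ Y := pushout.inl_desc _ _ _
  have h₂ : pushout.inr _ _ ≫ pushoutProductMap i g = W ◁ g := pushout.inr_desc _ _ _
  have sq : CommSq (pushout.desc a b h) (pushoutProductMap i g) p w := ⟨by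
    apply pushout.hom_ext
    · rw [reassoc_of% h₁, ← ha, ← Category.assoc, pushout.inl_desc]
    · rw [reassoc_of% h₂, ← hb, ← Category.assoc, pushout.inr_desc]⟩
  refine ⟨sq.lift, ?_, ?_, sq.fac_right⟩
  · rw [← h₁, Category.assoc, sq.fac_left, pushout.inl_desc]
  · rw [← h₂, Category.assoc, sq.fac_left, pushout.inr_desc]

theorem exists_lift_of_isCofibrant (hV : IsMonoidalModelCategory V) {Z W Y E B : V}
    (i : Z ⟶ W) (p : E ⟶ B) [Cofibration i]
    [IsCofibrant Y] [Fibration p] [WeakEquivalence p] {a : Z ⊗ Y ⟶ E} {w : W ⊗ Y ⟶ B}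
    (ha : a ≫ p = i ▷ Y ≫ w) : ∃ l : W ⊗ Y ⟶ E, i ▷ Y ≫ l = a ∧ l ≫ p = w := by
  obtain ⟨hZ⟩ := hV.isInitial_tensor Z
  obtain ⟨hW⟩ := hV.isInitial_tensor W
  obtain ⟨l, h₁, -, h₂⟩ := hV.exists_lift i (initial.to Y) p (a := a) (b := hW.to _)
    (hZ.hom_ext _ _) ha (hW.hom_ext _ _)
  exact ⟨l, h₁, h₂⟩

/-- The pushout-product of ∅ ⟶ `H` with `i` is `H ◁ i` up to isomorphism, as tensoring with ∅ gives
∅. -/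
theorem weakEquivalence_whiskerLeft (hV : IsMonoidalModelCategory V) {X Y : V} (H : V)
    [IsCofibrant H] (i : X ⟶ Y)
    [Cofibration i] [WeakEquivalence i] : WeakEquivalence (H ◁ i) := by
  obtain ⟨hX⟩ := hV.tensor_isInitial X
  obtain ⟨hY⟩ := hV.tensor_isInitial Y
  have : IsIso ((⊥_ V) ◁ i) := isIso_of_isInitial hX hY _
  have := (hV.pushoutProduct (initial.to H) i).2 (.inr inferInstance)
  have h : pushout.inr _ _ ≫ pushoutProductMap (initial.to H) i = H ◁ i :=
    pushout.inr_desc _ _ _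
  rw [← h]
  infer_instance

end IsMonoidalModelCategory

namespace LaxFamily.Cover

variable {A : LaxFamily TwoStep.{v} V} {Q : A.Cover}

/-- The projections of the universal lifts are trivial fibrations if the covering diagram is a
cofibrant replacement. -/
theorem universalMulLift_π (hV : IsMonoidalModelCategory V) [IsCofibrant (Q.obj 0)]
    [Cofibration (Q.map (TwoStep.le_one 0))] (hQ : ∀ c, Fibration (Q.proj c))
    (hQ' : ∀ c, WeakEquivalence (Q.proj c)) {c : TwoStep.{v}} (N : Q.UniversalMulLift c) :
    Fibration N.π ∧ WeakEquivalence N.π := by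
  suffices h : trivialFibrations V N.π from
    ⟨(fibration_iff _).2 h.1, (weakEquivalence_iff _).2 h.2⟩
  rw [← cofibrations_rlp]
  intro Z W i hi
  rw [← cofibration_iff] at hi
  refine ⟨fun {f w} sq ↦ ?_⟩
  suffices h : ∃ L : Q.MulLift w, ∀ {e e' : TwoStep.{v}} (h : c * e ≤ e'),
      i ▷ Q.obj e ≫ L.act h = f ▷ Q.obj e ≫ N.lift.act h by
    obtain ⟨L, hL⟩ := h
    obtain ⟨g, hg, hg'⟩ := N.exists_desc L
    refine ⟨⟨⟨g, N.hom_ext ?_ fun h ↦ ?_, hg⟩⟩⟩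
    · rw [Category.assoc, hg, sq.w]
    · rw [comp_whiskerRight_assoc, hg', hL]
  have : IsCofibrant (Q.obj 1) := isCofibrant_of_cofibration (Q.map (TwoStep.le_one 0))
  have hfac {e e' : TwoStep.{v}} (h : c * e ≤ e') :
      (f ▷ Q.obj e ≫ N.lift.act h) ≫ Q.proj e' = i ▷ Q.obj e ≫ (w ⊗ₘ Q.proj e) ≫ A.mul h := by
    rw [Category.assoc, N.lift.act_proj, whiskerRight_comp_tensorHom_assoc,
      whiskerRight_comp_tensorHom_assoc, sq.w]
  obtain rfl | rfl := c.eq_zero_or_eq_one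
  -- For `c = 0` every action factors through the single map from `Q.obj 1` to `Q.obj 0`, as 1 is
  -- the greatest source and 0 the least target. One lift against the cofibrant `Q.obj 1` suffices.
  · have h₀ : (0 : TwoStep.{v}) * 1 ≤ 0 := (mul_one _).le
    obtain ⟨φ, h₁, h₂⟩ := hV.exists_lift_of_isCofibrant i (Q.proj 0) (hfac h₀)
    refine ⟨⟨fun {e e'} h ↦ W ◁ Q.map e.le_one ≫ φ ≫ Q.map ((zero_mul e).ge.trans h), ?_, ?_, ?_⟩,
      ?_⟩
    · intro e e' k h h'
      rw [Category.assoc, Category.assoc, Q.map_comp]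
    · intro e e' k h h'
      rw [← whiskerLeft_comp_assoc, Q.map_comp]
    · intro e e' h
      rw [Category.assoc, Category.assoc, Q.map_proj, reassoc_of% h₂,
        whiskerLeft_comp_tensorHom_assoc, Q.map_proj, A.mul_map,
        ← A.map_whiskerLeft_mul e.le_one ((zero_mul _).le.trans ((zero_mul e).ge.trans h)),
        ← id_tensorHom, tensorHom_comp_tensorHom_assoc, Category.comp_id]
    · intro e e' h
      rw [← whisker_exchange_assoc, reassoc_of% h₁, whisker_exchange_assoc, reassoc_of% N.lift.map_act,
        N.lift.act_map]
  -- For `c = 1` a lift is a natural endomorphism of the diagram: `a` is found on `Q.obj 0`, then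
  -- extended to `b` along the pushout-product of `i` with `Q.obj 0 ⟶ Q.obj 1`.
  · have hle {e e' : TwoStep.{v}} (h : 1 * e ≤ e') : e ≤ e' := (one_mul e).ge.trans h
    suffices h : ∃ β : ∀ e, W ⊗ Q.obj e ⟶ Q.obj e,
        (∀ e, i ▷ _ ≫ β e = f ▷ _ ≫ N.lift.act (one_mul e).le) ∧
        (∀ e, β e ≫ Q.proj e = (w ⊗ₘ Q.proj e) ≫ A.mul (one_mul e).le) ∧
        ∀ {e e'} (h : e ≤ e'), β e ≫ Q.map h = W ◁ Q.map h ≫ β e' by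
      obtain ⟨β, h₁, h₂, h₃⟩ := h
      refine ⟨⟨fun {e e'} h ↦ β e ≫ Q.map (hle h), ?_, ?_, ?_⟩, ?_⟩
      · intro e e' k h h'
        rw [Category.assoc, Q.map_comp]
      · intro e e' k h h'
        rw [← reassoc_of% h₃ h, Q.map_comp]
      · intro e e' h
        rw [Category.assoc, Q.map_proj, reassoc_of% h₂, A.mul_map]
      · intro e e' h
        rw [reassoc_of% h₁, N.lift.act_map]
    obtain ⟨a, ha, ha'⟩ := hV.exists_lift_of_isCofibrant i (Q.proj 0) (hfac (one_mul 0).le)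
    obtain ⟨b, hb, hb', hb''⟩ := hV.exists_lift i (Q.map (TwoStep.le_one 0)) (Q.proj 1)
      (a := f ▷ _ ≫ N.lift.act (one_mul 1).le) (b := a ≫ Q.map (TwoStep.le_one 0))
      (w := (w ⊗ₘ Q.proj 1) ≫ A.mul (one_mul 1).le)
      (by rw [reassoc_of% ha, whisker_exchange_assoc, N.lift.map_act, N.lift.act_map])
      (hfac _)
      (by rw [Category.assoc, Q.map_proj, reassoc_of% ha', whiskerLeft_comp_tensorHom_assoc,
        Q.map_proj, A.mul_map, ← A.map_whiskerLeft_mul (TwoStep.le_one 0) (one_mul 1).le,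
        ← id_tensorHom, tensorHom_comp_tensorHom_assoc, Category.comp_id])
    refine ⟨fun e ↦ match e with
      | none => a
      | some _ => b, fun e ↦ ?_, fun e ↦ ?_, fun {e e'} h ↦ ?_⟩
    · obtain rfl | rfl := e.eq_zero_or_eq_one
      exacts [ha, hb]
    · obtain rfl | rfl := e.eq_zero_or_eq_one
      exacts [ha', hb'']
    · obtain rfl | rfl := e.eq_zero_or_eq_one
      · obtain rfl | rfl := e'.eq_zero_or_eq_one
        · change a ≫ _ = _ ≫ a
          rw [Q.map_rfl, Category.comp_id, whiskerLeft_id, Category.id_comp]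
        · exact hb'.symm
      · obtain rfl | rfl := e'.eq_zero_or_eq_one
        · exact absurd h TwoStep.not_one_le_zero
        · change b ≫ _ = _ ≫ b
          rw [Q.map_rfl, Category.comp_id, whiskerLeft_id, Category.id_comp]

end LaxFamily.Cover

end

/-! ### Cofibrant algebras, the key cofibration and the interval -/

section

variable {V : Type u} [Category.{v} V] [MonoidalCategory V]

variable (V) in
/-- The lax family with constant value the unit. -/
def LaxFamily.const (C : Type v) [Monoid C] [Preorder C] : LaxFamily C V where
  obj _ := 𝟙_ V
  unit := 𝟙 _
  mul _ := (λ_ _).hom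
  unit_mul _ := by simp
  mul_unit _ := by simp [unitors_equal]
  assoc _ _ _ _ := by simp [unitors_equal]

theorem LaxFamily.const_map {C : Type v} [Monoid C] [Preorder C] {c d : C} (h : c ≤ d) :
    (LaxFamily.const V C).map h = 𝟙 (𝟙_ V) := by
  simp [LaxFamily.map, LaxFamily.const, unitors_equal]

variable [ModelCategory V]

/-- Cofibrancy is recorded only as the splitting of trivial fibrations onto `A`, phrased colourwise,
so that the model structure on algebras is not needed afterwards. -/
theorem NSOperad.HasTransferredModelStructure.exists_cofibrant_replacement {C : Type v}
    {P : NSOperad.{v} C} (hP : P.HasTransferredModelStructure V) (K : P.Algebra V) :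
    ∃ (A : P.Algebra V) (a : A ⟶ K),
      (∀ c, Fibration (a.app c) ∧ WeakEquivalence (a.app c)) ∧
      ∀ (B : P.Algebra V) (p : B ⟶ A),
        (∀ c, Fibration (p.app c) ∧ WeakEquivalence (p.app c)) → ∃ s : A ⟶ B, s ≫ p = 𝟙 A := by
  obtain ⟨_, hf, hw⟩ := hP
  let F := MorphismProperty.factorizationData (cofibrations (P.Algebra V))
    (trivialFibrations (P.Algebra V)) (initial.to K)
  have hp := (mem_trivialFibrations_iff _).1 F.hp
  have hi : Cofibration F.i := (cofibration_iff _).2 F.hi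
  refine ⟨F.Z, F.p, fun c ↦ ⟨(hf _).1 hp.1 c, (hw _).1 hp.2 c⟩, fun B p h ↦ ?_⟩
  have : Fibration p := (hf _).2 fun c ↦ (h c).1
  have : WeakEquivalence p := (hw _).2 fun c ↦ (h c).2
  have sq : CommSq (initial.to B) F.i p (𝟙 _) := ⟨initialIsInitial.hom_ext _ _⟩
  exact ⟨sq.lift, sq.fac_right⟩

namespace LaxFamily

theorem exists_cover (A : LaxFamily TwoStep.{v} V) [IsCofibrant (𝟙_ V)] :
    ∃ (Q : A.Cover) (q : 𝟙_ V ⟶ Q.obj 1), IsCofibrant (Q.obj 0) ∧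
      Cofibration (coprod.desc q (Q.map (TwoStep.le_one 0))) ∧ q ≫ Q.proj 1 = A.unit ∧
      (∀ c, Fibration (Q.proj c)) ∧ ∀ c, WeakEquivalence (Q.proj c) := by
  let F := MorphismProperty.factorizationData (cofibrations V)
    (trivialFibrations V) (initial.to (A.obj 0))
  have hp := (mem_trivialFibrations_iff _).1 F.hp
  have hi : Cofibration F.i := (cofibration_iff _).2 F.hi
  have : IsCofibrant F.Z := (isCofibrant_iff_of_isInitial F.i initialIsInitial).2 hi
  -- Factoring out of the coproduct makes the unit and the transition map jointly a cofibration, not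
  -- merely each one separately.
  let G := MorphismProperty.factorizationData (cofibrations V)
    (trivialFibrations V) (coprod.desc A.unit (F.p ≫ A.map (TwoStep.le_one 0)))
  have hp' := (mem_trivialFibrations_iff _).1 G.hp
  have hi' : Cofibration G.i := (cofibration_iff _).2 G.hi
  let Q : A.Cover :=
    { obj := fun c ↦ match c with
        | none => F.Z
        | some _ => G.Z
      map := fun {c d} h ↦ match c, d, h with
        | none, none, _ => 𝟙 _
        | none, some _, _ => coprod.inr ≫ G.i
        | some _, some _, _ => 𝟙 _
        | some _, none, h => absurd h TwoStep.not_one_le_zero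
      map_rfl := fun c ↦ by
        obtain rfl | rfl := c.eq_zero_or_eq_one <;> rfl
      map_comp := fun {c d e} h h' ↦ by
        obtain _ | _ := c <;> obtain _ | _ := d <;> obtain _ | _ := e
        exacts [Category.id_comp _, Category.id_comp _, absurd h' TwoStep.not_one_le_zero,
          Category.comp_id _, absurd h TwoStep.not_one_le_zero,
          absurd h TwoStep.not_one_le_zero, absurd h' TwoStep.not_one_le_zero,
          Category.id_comp _]
      proj := fun c ↦ match c with
        | none => F.p
        | some _ => G.p
      map_proj := fun {c d} h ↦ by
        obtain _ | _ := c <;> obtain _ | _ := d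
        · exact (Category.id_comp _).trans
            ((Category.comp_id _).symm.trans (congrArg _ (A.map_rfl 0 h).symm))
        · exact (Category.assoc _ _ _).trans
            ((congrArg _ G.fac).trans (coprod.inr_desc _ _))
        · exact absurd h TwoStep.not_one_le_zero
        · exact (Category.id_comp _).trans
            ((Category.comp_id _).symm.trans (congrArg _ (A.map_rfl 1 h).symm)) }
  refine ⟨Q, coprod.inl ≫ G.i, this, ?_, ?_, ?_, ?_⟩
  · have : coprod.desc (coprod.inl ≫ G.i) (Q.map (TwoStep.le_one 0)) = G.i := by
      apply coprod.hom_ext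
      · exact coprod.inl_desc _ _
      · exact coprod.inr_desc _ _
    rw [this]
    exact hi'
  · change (coprod.inl ≫ G.i) ≫ G.p = _
    rw [Category.assoc, G.fac, coprod.inl_desc]
  · intro c
    obtain rfl | rfl := c.eq_zero_or_eq_one
    exacts [hp.1, hp'.1]
  · intro c
    obtain rfl | rfl := c.eq_zero_or_eq_one
    exacts [hp.2, hp'.2]

/-- For a lax family with the lifting property of cofibrant algebras, the unit and the transition
map are jointly a cofibration. -/
theorem cofibration_desc_unit_map (hV : IsMonoidalModelCategory V) [HasLimits V]
    [IsCofibrant (𝟙_ V)] (A : LaxFamily TwoStep.{v} V)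
    (hA : ∀ (N : LaxFamily TwoStep.{v} V) (π : ∀ c, N.obj c ⟶ A.obj c), IsHom N A π →
      (∀ c, Fibration (π c) ∧ WeakEquivalence (π c)) →
      ∃ σ : ∀ c, A.obj c ⟶ N.obj c, IsHom A N σ ∧ ∀ c, σ c ≫ π c = 𝟙 _) :
    Cofibration (coprod.desc A.unit (A.map (TwoStep.le_one 0))) := by
  obtain ⟨Q, q, _, hq, hq', hf, hw⟩ := A.exists_cover
  have : Cofibration (Q.map (TwoStep.le_one 0)) := by
    rw [← coprod.inr_desc q (Q.map (TwoStep.le_one 0))]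
    infer_instance
  let N (c : TwoStep.{v}) : Q.UniversalMulLift c :=
    (Q.nonempty_universalMulLift hV.closed_right c).some
  obtain ⟨σ, hσ, hσπ⟩ := hA _ _ (Cover.isHom_lifts_π N)
    (fun c ↦ Cover.universalMulLift_π hV hf hw (N c))
  obtain ⟨s, hs, hs₁, hs₂⟩ := Cover.exists_section N hσ hσπ q hq'
  -- The summand `𝟙_ V` is kept fixed; this needs the section to send the unit to `q`.
  have hr : RetractArrow (coprod.desc A.unit (A.map (TwoStep.le_one 0)))
      (coprod.desc q (Q.map (TwoStep.le_one 0))) :=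
    { i := Arrow.homMk (coprod.map (𝟙 _) (s 0)) (s 1) (by
        apply coprod.hom_ext <;> simp [hs₁, hs₂])
      r := Arrow.homMk (coprod.map (𝟙 _) (Q.proj 0)) (Q.proj 1) (by
        apply coprod.hom_ext <;> simp [hq', Q.map_proj])
      retract := by
        ext
        · apply coprod.hom_ext <;> simp [hs]
        · simp [hs] }
  rw [cofibration_iff] at hq ⊢
  exact (cofibrations V).of_retract hr hq

/-- The augmented ideal given by a lax family with an augmentation. -/
def toAugmentedIdeal (A : LaxFamily TwoStep.{v} V) {a : ∀ c, A.obj c ⟶ 𝟙_ V}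
    (ha : IsHom A (const V TwoStep.{v}) a) : AugmentedIdeal V where
  M := A.obj 1
  U := A.obj 0
  unit := A.unit
  mul := A.mul (one_mul 1).le
  left := A.mul (one_mul 0).le
  right := A.mul (mul_one 0).le
  d := A.map (TwoStep.le_one 0)
  aug := a 1
  augU := a 0
  unit_mul := A.unit_mul 1
  mul_unit := A.mul_unit 1
  assoc := A.assoc _ _ _ _
  left_d := by rw [A.mul_map, A.map_whiskerLeft_mul]
  right_d := by rw [A.mul_map, A.map_whiskerRight_mul]
  unit_aug := ha.unit
  mul_aug := ha.mul _
  left_aug := ha.mul _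
  right_aug := ha.mul _
  d_aug := (ha.map _).trans (by rw [const_map]; exact Category.comp_id _)

end LaxFamily

/-- The augmentation is a weak equivalence: multiplication by a path from the unit to the absorbing
element contracts `H`. -/
theorem AugmentedIdeal.QuotientMonoid.weakEquivalence_ε (hV : IsMonoidalModelCategory V)
    [IsCofibrant (𝟙_ V)] {D : AugmentedIdeal V} [Fibration D.aug] [WeakEquivalence D.aug]
    [Fibration D.augU] [WeakEquivalence D.augU] {H : V} [IsCofibrant H] {inl : D.M ⟶ H}
    {one : 𝟙_ V ⟶ H} (S : D.QuotientMonoid inl one) (w : D.d ≫ inl = D.augU ≫ one) :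
    WeakEquivalence S.ε := by
  let F := MorphismProperty.factorizationData (cofibrations V) (trivialFibrations V)
    (codiag (𝟙_ V))
  have hp := (mem_trivialFibrations_iff _).1 F.hp
  have : Fibration F.p := hp.1
  have : WeakEquivalence F.p := hp.2
  have : Cofibration F.i := (cofibration_iff _).2 F.hi
  have h₀ : (coprod.inl ≫ F.i) ≫ F.p = 𝟙 _ := by
    rw [Category.assoc, F.fac, coprod.inl_desc]
  have h₁ : (coprod.inr ≫ F.i) ≫ F.p = 𝟙 _ := by
    rw [Category.assoc, F.fac, coprod.inr_desc]
  have : WeakEquivalence (coprod.inl ≫ F.i) := weakEquivalence_of_postcomp_of_fac h₀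
  have : WeakEquivalence (coprod.inr ≫ F.i) := weakEquivalence_of_postcomp_of_fac h₁
  -- A point of the ideal: `U ⟶ I` is a trivial fibration and `I` is cofibrant.
  obtain ⟨t, ht⟩ : ∃ t : 𝟙_ V ⟶ D.U, t ≫ D.augU = 𝟙 _ := by
    have sq : CommSq (initial.to D.U) (initial.to (𝟙_ V)) D.augU (𝟙 _) :=
      ⟨initialIsInitial.hom_ext _ _⟩
    exact ⟨sq.lift, sq.fac_right⟩
  -- The lift in this square is a path in `M` from the unit to a point of the ideal; in `H` it runs
  -- from 0 to 1.
  have sq : CommSq (coprod.desc D.unit (t ≫ D.d)) F.i D.aug F.p := ⟨by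
    rw [F.fac]
    apply coprod.hom_ext <;> simp [D.unit_aug, D.d_aug, ht]⟩
  have hγ₀ : (coprod.inl ≫ F.i) ≫ sq.lift ≫ inl = D.unit ≫ inl := by
    rw [Category.assoc, sq.fac_left_assoc, coprod.inl_desc_assoc]
  have hγ₁ : (coprod.inr ≫ F.i) ≫ sq.lift ≫ inl = one := by
    rw [Category.assoc, sq.fac_left_assoc, coprod.inr_desc_assoc, Category.assoc, w,
      reassoc_of% ht]
  have hΓ₀ : H ◁ (coprod.inl ≫ F.i) ≫ H ◁ (sq.lift ≫ inl) ≫ S.mul = (ρ_ H).hom := by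
    rw [← whiskerLeft_comp_assoc, hγ₀, S.mul_zero]
  have hΓ₁ : H ◁ (coprod.inr ≫ F.i) ≫ H ◁ (sq.lift ≫ inl) ≫ S.mul =
      (ρ_ H).hom ≫ S.ε ≫ one := by
    rw [← whiskerLeft_comp_assoc, hγ₁, S.mul_one]
  have := hV.weakEquivalence_whiskerLeft H (coprod.inl ≫ F.i)
  have := hV.weakEquivalence_whiskerLeft H (coprod.inr ≫ F.i)
  -- Two-out-of-three at the end 0, where the homotopy is the identity up to the unitor; the end 1
  -- then handles `S.ε ≫ one`.
  have : WeakEquivalence (H ◁ (sq.lift ≫ inl) ≫ S.mul) := weakEquivalence_of_precomp_of_fac hΓ₀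
  have : WeakEquivalence ((ρ_ H).hom ≫ S.ε ≫ one) := by
    rw [← hΓ₁]
    infer_instance
  have h : WeakEquivalence (S.ε ≫ one) := weakEquivalence_of_precomp (ρ_ H).hom _
  have hr : RetractArrow S.ε (S.ε ≫ one) :=
    { i := Arrow.homMk (𝟙 _) one (Category.id_comp _)
      r := Arrow.homMk (𝟙 _) S.ε (by simp [S.one_ε])
      retract := by ext <;> simp [S.one_ε] }
  rw [weakEquivalence_iff] at h ⊢
  exact (weakEquivalences V).of_retract hr h

theorem AugmentedIdeal.nonempty_monoidalInterval (hV : IsMonoidalModelCategory V)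
    [IsCofibrant (𝟙_ V)] (D : AugmentedIdeal V) (hD : Cofibration (coprod.desc D.unit D.d))
    [Fibration D.aug] [WeakEquivalence D.aug] [Fibration D.augU] [WeakEquivalence D.augU] :
    Nonempty (MonoidalInterval V) := by
  let inl := pushout.inl D.d D.augU
  let one := pushout.inr D.d D.augU
  obtain ⟨S⟩ := D.nonempty_quotientMonoid hV.closed_left hV.closed_right
    (IsPushout.of_hasPushout D.d D.augU)
  -- Adding a summand `𝟙_ V` to both the ideal and the point leaves the pushout unchanged, and shows
  -- (0,1) to be a cobase change of (unit, d).
  have hpo : IsPushout (coprod.desc D.unit D.d) (coprod.map (𝟙 (𝟙_ V)) D.augU) inl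
      (coprod.desc (D.unit ≫ inl) one) := by
    refine ⟨⟨?_⟩, ⟨PushoutCocone.IsColimit.mk _
      (fun s ↦ pushout.desc s.inl (coprod.inr ≫ s.inr) ?_) (fun s ↦ ?_) (fun s ↦ ?_)
      (fun s m h₁ h₂ ↦ ?_)⟩⟩
    · apply coprod.hom_ext <;> simp [inl, one, pushout.condition]
    · have := coprod.inr ≫= s.condition
      rwa [coprod.inr_desc_assoc, coprod.inr_map_assoc] at this
    · exact pushout.inl_desc _ _ _
    · have := coprod.inl ≫= s.condition
      rw [coprod.inl_desc_assoc, coprod.inl_map_assoc, Category.id_comp] at this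
      apply coprod.hom_ext
      · rw [coprod.inl_desc_assoc, Category.assoc, pushout.inl_desc, this]
      · rw [coprod.inr_desc_assoc, pushout.inr_desc]
    · apply pushout.hom_ext
      · rw [pushout.inl_desc]
        exact h₁
      · rw [pushout.inr_desc, ← h₂, coprod.inr_desc_assoc]
  have hcof : Cofibration (coprod.desc (D.unit ≫ inl) one) := by
    rw [cofibration_iff] at hD ⊢
    exact MorphismProperty.of_isPushout hpo.flip hD
  refine ⟨⟨_, D.unit ≫ inl, one, S.ε, ?_, hcof, ?_, S.mul, S.mul_assoc, S.zero_mul, S.mul_zero,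
    S.one_mul, S.mul_one⟩⟩
  · apply coprod.hom_ext <;> simp [one, inl, S.inl_ε, S.one_ε, D.unit_aug]
  · have hone : one = coprod.inr ≫ coprod.desc (D.unit ≫ inl) one := (coprod.inr_desc _ _).symm
    have : Cofibration one := by
      rw [hone]
      infer_instance
    have : IsCofibrant (pushout D.d D.augU) := isCofibrant_of_cofibration one
    exact S.weakEquivalence_ε hV pushout.condition

end

theorem mainTheorem10 {V : Type u} [Category.{v} V] [MonoidalCategory V]
    [HasLimits V] [HasColimits V] [ModelCategory V]
    (hV : IsAdequate V) (hunit : IsCofibrant (𝟙_ V)) :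
    Nonempty (MonoidalInterval V) := by
  have hV' := hV.compactlyGenerated.monoidal
  obtain ⟨A, a, ha, hA⟩ := (hV.transferred TwoStep.{v}
    (orderedOperad TwoStep.{v})).exists_cofibrant_replacement
      (LaxFamily.const V TwoStep.{v}).toAlgebra
  -- The section of a trivial fibration of lax families is found among algebras, where the
  -- cofibrancy of `A` lives.
  have hcof := A.toLaxFamily.cofibration_desc_unit_map hV' fun N π hπ h ↦ by
    let p : N.toAlgebra ⟶ A := LaxFamily.IsHom.toAlgebraHom (B := A) hπ
    obtain ⟨s, hs⟩ := hA _ p h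
    exact ⟨s.app, LaxFamily.isHom_toAlgebra_app s,
      fun c ↦ congrFun (congrArg NSOperad.Algebra.Hom.app hs) c⟩
  let D := A.toLaxFamily.toAugmentedIdeal (LaxFamily.isHom_toAlgebra_app a)
  have : Fibration D.aug := (ha 1).1
  have : WeakEquivalence D.aug := (ha 1).2
  have : Fibration D.augU := (ha 0).1
  have : WeakEquivalence D.augU := (ha 0).2
  exact D.nonempty_monoidalInterval hV' hcof
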